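/- **Setting.** Let $X$ be a set with a Hausdorff topology $\tau$, an extended distance $\mathsf d:X\times X\to[0,\infty]$ (symmetric, triangle inequality, $\mathsf d(x,y)=0$ iff $x=y$) and a finite Borel measure $\mathfrak m$ on $(X,\tau)$ that is inner regular with respect to $\tau$-compact sets. For $f:X\to\mathbb R$ and $A\subseteq X$ put $\mathrm{Lip}(f,A,\mathsf d)=\sup\{|f(x)-f(y)|/\mathsf d(x,y): x,y\in A,\ x\ne y\}$ (with $\sup\varnothing=0$) and $\mathrm{Lip}(f,\mathsf d)=\mathrm{Lip}(f,X,\mathsf d)$. Let $\mathrm{Lip}_b(X,\tau,\mathsf d)$ be the algebra of bounded, $\tau$-continuous, $\mathsf d$-Lipschitz functions $f:X\to\mathbb R$, with norm $\|f\|=\mathrm{Lip}(f,\mathsf d)+\sup_X|f|$, and let $\mathrm{lip}_{\mathsf d}(f)(x)=\inf\{\mathrm{Lip}(f,U,\mathsf d): x\in U\in\tau\}$. Assume that $\mathbb X=(X,\tau,\mathsf d,\mathfrak m)$ is an extended metric-topological measure space, that is, $\tau$ is the initial topology of $\mathrm{Lip}_b(X,\tau,\mathsf d)$ and $\mathsf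 d(x,y)=\sup\{|f(x)-f(y)|: f\in\mathrm{Lip}_b(X,\tau,\mathsf d),\ \mathrm{Lip}(f,\mathsf d)\le 1\}$ for all $x,y\in X$. **Derivations.** A Lipschitz derivation is a linear map $b:\mathrm{Lip}_b(X,\tau,\mathsf d)\to L^0(\mathfrak m)$ with $b(fg)=f\,b(g)+g\,b(f)$ for all $f,g$. * $b$ is a *Weaver derivation*, $b\in\mathscr X(\mathbb X)$, if $b(f)\in L^\infty(\mathfrak m)$ for every $f$ and $b$, restricted to the closed unit ball of $\mathrm{Lip}_b(X,\tau,\mathsf d)$, is sequentially continuous from the topology of pointwise convergence to the weak$^*$ topology of $L^\infty(\mathfrak m)=L^1(\mathfrak m)'$. For such $b$, $|b|_W$ is the infimum (for the $\mathfrak m$-a.e. order) of all $g\in L^\infty(\mathfrak m)$, $g\ge 0$, such that $|b(f)|\le g\|f\|$ $\mathfrak m$-a.e. for every $f\in\mathrm{Lip}_b(X,\tau,\mathsf d)$. * $b$ is a *bounded Di Marino derivation*, $b\in\mathrm{Der}^\infty(\mathbb X)$, if there is $g\in L^\infty(\mathfrak m)$, $g\ge0$, with $|b(f)|\le g\,\mathrm{lip}_{\mathsf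 d}(f)$ $\mathfrak m$-a.e. for every $f\in\mathrm{Lip}_b(X,\tau,\mathsf d)$. For such $b$, $|b|$ is the infimum of all $g\in L^0(\mathfrak m)$, $g\ge 0$, with this property. * $b\in\mathrm{Der}^\infty_1(\mathbb X)$ if $b\in\mathrm{Der}^\infty(\mathbb X)$, $b(f)\in L^1(\mathfrak m)$ for every $f$, and there is $\mathrm{div}(b)\in L^1(\mathfrak m)$ with $\int b(f)\,d\mathfrak m=-\int f\,\mathrm{div}(b)\,d\mathfrak m$ for every $f\in\mathrm{Lip}_b(X,\tau,\mathsf d)$. **Theorem.** Assume that $\mathfrak m$ is separable, i.e. there is a countable family $\mathcal C$ of Borel sets such that for every Borel set $E$ and $\varepsilon>0$ some $F\in\mathcal C$ satisfies $\mathfrak m(E\,\Delta\,F)<\varepsilon$. Then $\mathrm{Der}^\infty_1(\mathbb X)\subseteq\mathscr X(\mathbb X)$, and for every $b\in\mathrm{Der}^\infty_1(\mathbb X)$ the infima $|b|_W$ and $|b|$ exist and $|b|_W\le|b|$ $\mathfrak m$-a.e. on $X$. If in addition $\tau$ is metrisable on every $\tau$-compact subset of $X$, then $\mathscr X(\mathbb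 X)\subseteq\mathrm{Der}^\infty(\mathbb X)$, and for every $b\in\mathscr X(\mathbb X)$ the infima $|b|_W$ and $|b|$ exist and $|b|_W=|b|$ $\mathfrak m$-a.e. on $X$. -/

import Mathlib

open MeasureTheory Filter Topology
open scoped ENNReal NNReal BoundedContinuousFunction

/-- An extended distance on `X`: symmetric, with values in `[0, ∞]`, satisfying the triangle
inequality and vanishing exactly on the diagonal. It is kept separate from the topology of `X`. -/
structure ExtDist (X : Type*) where
  dist : X → X → ℝ≥0∞
  dist_eq_zero : ∀ x y, dist x y = 0 ↔ x = y
  symm : ∀ x y, dist x y = dist y x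
  triangle : ∀ x y z, dist x z ≤ dist x y + dist y z

/-- The algebra `Lip_b(X, τ, d)` of bounded, `τ`-continuous, `d`-Lipschitz real functions
(`τ` is the topology of the type `X`). -/
def LipB {X : Type*} [TopologicalSpace X] (d : ExtDist X) : Subalgebra ℝ (X →ᵇ ℝ) where
  carrier := {f | ∃ L : ℝ≥0, ∀ x y, edist (f x) (f y) ≤ L * d.dist x y}
  mul_mem' := by
    rintro f g ⟨K, hK⟩ ⟨L, hL⟩
    refine ⟨‖f‖₊ * L + ‖g‖₊ * K, fun x y => ?_⟩
    have hf := hK x y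
    have hg := hL x y
    rw [edist_eq_enorm_sub] at hf hg ⊢
    have hfx : ‖f x‖ₑ ≤ (‖f‖₊ : ℝ≥0∞) := by
      rw [enorm_eq_nnnorm]; exact_mod_cast f.norm_coe_le_norm x
    have hgy : ‖g y‖ₑ ≤ (‖g‖₊ : ℝ≥0∞) := by
      rw [enorm_eq_nnnorm]; exact_mod_cast g.norm_coe_le_norm y
    have hsplit : (f * g) x - (f * g) y = f x * (g x - g y) + g y * (f x - f y) := by
      simp only [BoundedContinuousFunction.mul_apply]; ring
    calc ‖(f * g) x - (f * g) y‖ₑ = ‖f x * (g x - g y) + g y * (f x - f y)‖ₑ := by rw [hsplit]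
      _ ≤ ‖f x * (g x - g y)‖ₑ + ‖g y * (f x - f y)‖ₑ := enorm_add_le _ _
      _ = ‖f x‖ₑ * ‖g x - g y‖ₑ + ‖g y‖ₑ * ‖f x - f y‖ₑ := by rw [enorm_mul, enorm_mul]
      _ ≤ ‖f‖₊ * (L * d.dist x y) + ‖g‖₊ * (K * d.dist x y) := by gcongr
      _ = ((‖f‖₊ * L + ‖g‖₊ * K : ℝ≥0) : ℝ≥0∞) * d.dist x y := by push_cast; ring
  add_mem' := by
    rintro f g ⟨K, hK⟩ ⟨L, hL⟩
    refine ⟨K + L, fun x y => ?_⟩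
    calc edist ((f + g) x) ((f + g) y) ≤ edist (f x) (f y) + edist (g x) (g y) := by
          simpa using edist_add_add_le (f x) (g x) (f y) (g y)
      _ ≤ K * d.dist x y + L * d.dist x y := add_le_add (hK x y) (hL x y)
      _ = ((K + L : ℝ≥0) : ℝ≥0∞) * d.dist x y := by push_cast; ring
  algebraMap_mem' r := ⟨0, fun x y => by simp [BoundedContinuousFunction.algebraMap_apply]⟩

namespace LipB

variable {X : Type*} [TopologicalSpace X] {d : ExtDist X}

/-- `Lip(f, A, d)`, the least Lipschitz constant of `f` on the set `A`, as an element of `[0, ∞]`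
(it is finite for `f ∈ Lip_b(X, τ, d)`, and `0` if `A` has at most one point). -/
noncomputable def lipOn (f : LipB d) (A : Set X) : ℝ≥0∞ :=
  ⨆ x ∈ A, ⨆ y ∈ A, ⨆ _ : x ≠ y, edist (f.1 x) (f.1 y) / d.dist x y

/-- The norm `Lip(f, d) + sup |f|` of `Lip_b(X, τ, d)`. -/
noncomputable def lipNorm (f : LipB d) : ℝ :=
  (lipOn f Set.univ).toReal + ‖f.1‖

/-- The asymptotic slope `lip_d(f)(x) = inf {Lip(f, U, d) | x ∈ U, U is τ-open}`. -/
noncomputable def slope (f : LipB d) (x : X) : ℝ :=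
  (⨅ (U : Set X) (_ : IsOpen U) (_ : x ∈ U), lipOn f U).toReal

end LipB

/-- `(X, τ, d, m)` is an extended metric-topological measure space. -/
structure IsEMTMSpace {X : Type*} [TopologicalSpace X] [MeasurableSpace X]
    (d : ExtDist X) (m : Measure X) : Prop where
  hausdorff : T2Space X
  /-- `τ` is the initial topology of `Lip_b(X, τ, d)` -/
  initial : ‹TopologicalSpace X› = ⨅ f : LipB d, TopologicalSpace.induced (fun x => f.1 x) inferInstance
  /-- `d` is recovered from the functions of `Lip_b(X, τ, d)` that are `1`-Lipschitz -/
  recovery : ∀ x y, d.dist x y =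
    ⨆ (f : LipB d) (_ : LipB.lipOn f Set.univ ≤ 1), edist (f.1 x) (f.1 y)
  /-- `m` is a finite Radon measure on the Borel `σ`-algebra of `τ` -/
  borel : BorelSpace X
  finite : IsFiniteMeasure m
  radon : m.InnerRegular

/-- A Lipschitz derivation: a linear operator `b : Lip_b(X, τ, d) → L⁰(m)` satisfying the Leibniz
rule. -/
structure LipDer {X : Type*} [TopologicalSpace X] [MeasurableSpace X]
    (d : ExtDist X) (m : Measure X) where
  op : LipB d →ₗ[ℝ] (X →ₘ[m] ℝ)
  leibniz : ∀ f g : LipB d,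
    ∀ᵐ x ∂m, op (f * g) x = f.1 x * op g x + g.1 x * op f x

section Derivations

variable {X : Type*} [TopologicalSpace X] [MeasurableSpace X] (d : ExtDist X) (m : Measure X)

/-- The set of Weaver derivations: those `b` with values in `L^∞(m)` whose restriction to the closed
unit ball of `Lip_b(X, τ, d)` is sequentially continuous from the topology of pointwise convergence
to the weak-star topology of `L^∞(m)` (as the dual of `L¹(m)`). -/
def WeaverDer : Set (LipDer d m) :=
  {b | (∀ f, b.op f ∈ Lp ℝ ∞ m) ∧
    ∀ (u : ℕ → LipB d) (f : LipB d), (∀ n, LipB.lipNorm (u n) ≤ 1) → LipB.lipNorm f ≤ 1 →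
      (∀ x, Tendsto (fun n => (u n).1 x) atTop (𝓝 (f.1 x))) →
      ∀ h : X → ℝ, Integrable h m →
        Tendsto (fun n => ∫ x, h x * b.op (u n) x ∂m) atTop (𝓝 (∫ x, h x * b.op f x ∂m))}

variable {d m}

/-- `b` has divergence `δ`. -/
def LipDer.HasDiv (b : LipDer d m) (δ : X → ℝ) : Prop :=
  (∀ f, Integrable (b.op f) m) ∧ Integrable δ m ∧
    ∀ f : LipB d, ∫ x, b.op f x ∂m = -∫ x, f.1 x * δ x ∂m

/-- The non-negative `g ∈ L⁰(m)` with `|b(f)| ≤ g lip_d(f)` almost everywhere for every `f`. -/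
def LipDer.slopeBounds (b : LipDer d m) : Set (X →ₘ[m] ℝ) :=
  {g | 0 ≤ g ∧ ∀ f : LipB d, ∀ᵐ x ∂m, |b.op f x| ≤ g x * LipB.slope f x}

/-- The non-negative `g ∈ L^∞(m)` with `|b(f)| ≤ g ‖f‖` almost everywhere for every `f`, where `‖f‖`
is the norm of `Lip_b(X, τ, d)`. -/
def LipDer.normBounds (b : LipDer d m) : Set (X →ₘ[m] ℝ) :=
  {g | g ∈ Lp ℝ ∞ m ∧ 0 ≤ g ∧ ∀ f : LipB d, ∀ᵐ x ∂m, |b.op f x| ≤ g x * LipB.lipNorm f}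

/-- The greatest lower bound of a set of elements of `L⁰(m)`, for the order given by the almost
everywhere inequality; it is meant for sets that have one (the value is `0` otherwise). -/
noncomputable def essMeet (S : Set (X →ₘ[m] ℝ)) : X →ₘ[m] ℝ :=
  open Classical in if h : ∃ g, IsGLB S g then h.choose else 0

/-- `|b|`, for a Di Marino derivation `b`. -/
noncomputable def LipDer.absDM (b : LipDer d m) : X →ₘ[m] ℝ := essMeet b.slopeBounds

/-- `|b|_W`, for a Weaver derivation `b`. -/
noncomputable def LipDer.absW (b : LipDer d m) : X →ₘ[m] ℝ := essMeet b.normBounds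

variable (d m)

/-- `Der^q(X)`: the Di Marino derivations that have a bound `g ∈ L^q(m)`. -/
def DerQ (q : ℝ≥0∞) : Set (LipDer d m) :=
  {b | ∃ g ∈ b.slopeBounds, g ∈ Lp ℝ q m}

/-- `Der^q_r(X)`: the elements of `Der^q(X)` that have a divergence, which lies in `L^r(m)`. -/
def DerQR (q r : ℝ≥0∞) : Set (LipDer d m) :=
  {b | b ∈ DerQ d m q ∧ ∃ δ : X → ℝ, b.HasDiv δ ∧ MemLp δ r m}

end Derivations

/-!
The theorem rests on three facts. The first two are about `Lip_b`, and follow from its lattice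
structure and the recovery of `d` by its `1`-Lipschitz functions; the third follows from the Leibniz
rule and the continuity of a Weaver derivation.

*Density* (`IsEMTMSpace.exists_integral_abs_sub_le`). A lattice form of the Stone–Weierstrass
theorem gives cutoff functions in `Lip_b` between disjoint compact sets, so `Lip_b` is dense in
`L¹(m)`. For a Di Marino derivation with divergence, the weak-star continuity has then only to
be tested against `φ ∈ Lip_b`, where `∫ φ b(u) = -∫ u (φ div b + b(φ))` reduces it to dominated
convergence. The norm of `Lip_b` dominates the slope, so bounds for the slope are bounds for the
norm, and `|b|_W ≤ |b|`.

*Extension* (`LipB.exists_extension`). A continuous function on a compact set that is `L`-Lipschitz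
extends to a member of `Lip_b` that is `L'`-Lipschitz, for any `L' > L`.

*Locality* (`WeaverDer.ae_eq_zero_of_eq_zero`). A Weaver derivation `b` satisfies `b(f) = 0` almost
everywhere on `{f = 0}`.

For a Weaver derivation, the Banach–Steinhaus theorem yields a bound `|b(f)| ≤ g ‖f‖`
(`WeaverDer.normBounds_nonempty`). Locality lets one cut `f` into thin slices of its range, which
removes the supremum from the norm and leaves `|b(f)| ≤ g Lip(f, d)`. By locality and extension this
localises to compact subsets of an open set `U` in the form `|b(f)| ≤ g Lip(f, U, d)`, and inner
regularity of `m` gives `|b(f)| ≤ g lip_d(f)` with the same `g` (`WeaverDer.mem_slopeBounds`). Hence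
the two sets of bounds have the same least element.

The infima exist, and are attained, because a set of bounds is closed under countable infima
(`exists_isLeast_bounds`).
-/

/-! ### Lipschitz functions for an extended distance -/

/-- `f` is `L`-Lipschitz for `d`. With `L = 0` this forces `f x = f y` even when `d x y = ∞`,
because `0 * ∞ = 0`; for this reason `LipB.edist_le_of_lipOn_le` needs a positive constant. -/
def ExtDist.IsLip {X : Type*} (d : ExtDist X) (L : ℝ≥0) (f : X → ℝ) : Prop :=
  ∀ x y, edist (f x) (f y) ≤ L * d.dist x y

namespace ExtDist.IsLip

variable {X : Type*} {d : ExtDist X} {L : ℝ≥0} {f g : X → ℝ}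

lemma const (d : ExtDist X) (L : ℝ≥0) (c : ℝ) : d.IsLip L (fun _ => c) := fun x y => by simp

lemma mono {L' : ℝ≥0} (hf : d.IsLip L f) (h : L ≤ L') : d.IsLip L' f := fun x y =>
  (hf x y).trans (by gcongr)

lemma sup (hf : d.IsLip L f) (hg : d.IsLip L g) : d.IsLip L (fun x => f x ⊔ g x) := fun x y => by
  rcases le_total (edist (f x) (f y)) (edist (g x) (g y)) with h | h
  all_goals
    refine le_trans ?_ (max_le (hf x y) (hg x y))
    simp only [edist_dist, Real.dist_eq]
    rw [← ENNReal.ofReal_max]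
    exact ENNReal.ofReal_le_ofReal (abs_max_sub_max_le_max _ _ _ _)

lemma inf (hf : d.IsLip L f) (hg : d.IsLip L g) : d.IsLip L (fun x => f x ⊓ g x) := fun x y => by
  refine le_trans ?_ (max_le (hf x y) (hg x y))
  simp only [edist_dist, Real.dist_eq]
  rw [← ENNReal.ofReal_max]
  exact ENNReal.ofReal_le_ofReal (abs_min_sub_min_le_max _ _ _ _)

lemma add_const (hf : d.IsLip L f) (c : ℝ) : d.IsLip L (fun x => f x + c) := fun x y => by
  simpa using hf x y

lemma of_tendsto {u : ℕ → X → ℝ} (hu : ∀ n, d.IsLip L (u n))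
    (h : ∀ x, Tendsto (fun n => u n x) atTop (𝓝 (f x))) : d.IsLip L f := fun x y =>
  le_of_tendsto ((h x).edist (h y)) (Eventually.of_forall fun n => hu n x y)

end ExtDist.IsLip

namespace LipB

variable {X : Type*} [TopologicalSpace X] {d : ExtDist X}

lemma sup_mem {f g : X →ᵇ ℝ} (hf : f ∈ LipB d) (hg : g ∈ LipB d) : f ⊔ g ∈ LipB d := by
  obtain ⟨K, hK⟩ := hf
  obtain ⟨L, hL⟩ := hg
  exact ⟨max K L, ExtDist.IsLip.sup (ExtDist.IsLip.mono hK (le_max_left _ _))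
    (ExtDist.IsLip.mono hL (le_max_right _ _))⟩

lemma inf_mem {f g : X →ᵇ ℝ} (hf : f ∈ LipB d) (hg : g ∈ LipB d) : f ⊓ g ∈ LipB d := by
  obtain ⟨K, hK⟩ := hf
  obtain ⟨L, hL⟩ := hg
  exact ⟨max K L, ExtDist.IsLip.inf (ExtDist.IsLip.mono hK (le_max_left _ _))
    (ExtDist.IsLip.mono hL (le_max_right _ _))⟩

lemma const_mem (c : ℝ) : BoundedContinuousFunction.const X c ∈ LipB d :=
  ⟨0, fun x y => by simp⟩

lemma lipOn_le_iff {f : LipB d} {A : Set X} {a : ℝ≥0∞} :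
    lipOn f A ≤ a ↔ ∀ x ∈ A, ∀ y ∈ A, x ≠ y → edist (f.1 x) (f.1 y) / d.dist x y ≤ a := by
  simp [lipOn]

/-- For a positive constant the quotients bounded by `lipOn` control all the increments: at infinite
distance the quotient is `0`, and `L * ∞ = ∞`. -/
lemma edist_le_of_lipOn_le {f : LipB d} {A : Set X} {L : ℝ≥0} (hL : 0 < L) (h : lipOn f A ≤ L)
    {x y : X} (hx : x ∈ A) (hy : y ∈ A) : edist (f.1 x) (f.1 y) ≤ L * d.dist x y := by
  by_cases hxy : x = y
  · simp [hxy]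
  · have h0 : d.dist x y ≠ 0 := fun h0 => hxy ((d.dist_eq_zero x y).1 h0)
    have := lipOn_le_iff.1 h x hx y hy hxy
    rwa [ENNReal.div_le_iff_le_mul (Or.inl h0) (Or.inr (by exact_mod_cast hL.ne'))] at this

lemma lipOn_le_of_isLip {f : LipB d} {L : ℝ≥0} (h : d.IsLip L f.1) (A : Set X) :
    lipOn f A ≤ L :=
  lipOn_le_iff.2 fun x _ y _ _ => ENNReal.div_le_of_le_mul (h x y)

lemma lipOn_ne_top (f : LipB d) (A : Set X) : lipOn f A ≠ ∞ := by
  obtain ⟨L, hL⟩ := f.2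
  exact ne_top_of_le_ne_top ENNReal.coe_ne_top (lipOn_le_of_isLip hL A)

lemma lipOn_smul_le (c : ℝ) (f : LipB d) (A : Set X) : lipOn (c • f) A ≤ ‖c‖ₑ * lipOn f A := by
  refine lipOn_le_iff.2 fun x hx y hy hxy => ?_
  have h := lipOn_le_iff.1 (le_refl (lipOn f A)) x hx y hy hxy
  have : edist ((c • f).1 x) ((c • f).1 y) = ‖c‖ₑ * edist (f.1 x) (f.1 y) := by
    rw [edist_eq_enorm_sub, edist_eq_enorm_sub, ← enorm_mul]
    congr 1
    change c * f.1 x - c * f.1 y = _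
    ring
  rw [this, mul_div_assoc]
  gcongr

lemma lipNorm_nonneg (f : LipB d) : 0 ≤ lipNorm f :=
  add_nonneg ENNReal.toReal_nonneg (norm_nonneg _)

lemma lipNorm_smul_le (c : ℝ) (f : LipB d) : lipNorm (c • f) ≤ |c| * lipNorm f := by
  unfold lipNorm
  have h1 : (lipOn (c • f) Set.univ).toReal ≤ |c| * (lipOn f Set.univ).toReal := by
    have := ENNReal.toReal_mono (ENNReal.mul_ne_top (by simp) (lipOn_ne_top f Set.univ))
      (lipOn_smul_le c f Set.univ)
    simpa [ENNReal.toReal_mul] using this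
  have h2 : ‖(c • f).1‖ = |c| * ‖f.1‖ := by
    change ‖c • f.1‖ = _
    rw [norm_smul, Real.norm_eq_abs]
  rw [h2, mul_add]
  gcongr

lemma lipNorm_le {f : LipB d} {L : ℝ≥0} {M : ℝ} (hM : 0 ≤ M) (h : d.IsLip L f.1)
    (hf : ∀ x, |f.1 x| ≤ M) : lipNorm f ≤ L + M := by
  refine add_le_add ?_ ((BoundedContinuousFunction.norm_le hM).2 hf)
  simpa using ENNReal.toReal_mono ENNReal.coe_ne_top (lipOn_le_of_isLip h Set.univ)

lemma toReal_lipOn_le_lipNorm (f : LipB d) : (lipOn f Set.univ).toReal ≤ lipNorm f :=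
  le_add_of_nonneg_right (norm_nonneg _)

lemma abs_le_lipNorm (f : LipB d) (x : X) : |f.1 x| ≤ lipNorm f :=
  (f.1.norm_coe_le_norm x).trans (le_add_of_nonneg_left ENNReal.toReal_nonneg)

lemma slope_nonneg (f : LipB d) (x : X) : 0 ≤ slope f x := ENNReal.toReal_nonneg

lemma slope_le_lipNorm (f : LipB d) (x : X) : slope f x ≤ lipNorm f := by
  refine (ENNReal.toReal_mono (lipOn_ne_top f Set.univ) ?_).trans (toReal_lipOn_le_lipNorm f)
  exact iInf_le_of_le Set.univ (iInf_le_of_le isOpen_univ (iInf_le _ (Set.mem_univ x)))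

lemma exists_isOpen_lipOn_le_of_slope_lt {f : LipB d} {x : X} {q : ℝ} (h : slope f x < q) :
    ∃ U : Set X, IsOpen U ∧ x ∈ U ∧ lipOn f U ≤ ENNReal.ofReal q := by
  have h' : (⨅ (U : Set X) (_ : IsOpen U) (_ : x ∈ U), lipOn f U) < ENNReal.ofReal q := by
    refine (ENNReal.lt_ofReal_iff_toReal_lt ?_).2 h
    refine ne_top_of_le_ne_top (lipOn_ne_top f Set.univ) ?_
    exact iInf_le_of_le Set.univ (iInf_le_of_le isOpen_univ (iInf_le _ (Set.mem_univ x)))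
  simp only [iInf_lt_iff] at h'
  obtain ⟨U, hU, hx, h'⟩ := h'
  exact ⟨U, hU, hx, h'.le⟩

end LipB

/-! ### Approximation and extension of Lipschitz functions -/

section Approximation

variable {X : Type*} [TopologicalSpace X]

/-- The lattice form of the Stone–Weierstrass theorem, for the approximation of one function: a
lattice of functions that interpolates `f` at each pair of points of `K` approximates `f` uniformly
on `K`. -/
lemma exists_forall_abs_sub_lt_of_lattice {K : Set X} (hK : IsCompact K) {S : Set (X →ᵇ ℝ)}
    (hne : S.Nonempty) (hsup : ∀ φ ∈ S, ∀ ψ ∈ S, φ ⊔ ψ ∈ S) (hinf : ∀ φ ∈ S, ∀ ψ ∈ S, φ ⊓ ψ ∈ S)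
    {f : X → ℝ} (hf : ContinuousOn f K)
    (hS : ∀ x ∈ K, ∀ y ∈ K, ∃ φ ∈ S, φ x = f x ∧ φ y = f y) {ε : ℝ} (hε : 0 < ε) :
    ∃ φ ∈ S, ∀ x ∈ K, |φ x - f x| < ε := by
  rcases K.eq_empty_or_nonempty with rfl | ⟨x₀, hx₀⟩
  · obtain ⟨φ, hφ⟩ := hne
    exact ⟨φ, hφ, by simp⟩
  have lower : ∀ x ∈ K, ∃ φ ∈ S, φ x = f x ∧ ∀ z ∈ K, f z - ε < φ z := by
    intro x hx
    have key : ∃ φ ∈ S, φ x = f x ∧ ∀ z ∈ K, z ∈ K → f z - ε < φ z := by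
      refine hK.induction_on (p := fun s => ∃ φ ∈ S, φ x = f x ∧ ∀ z ∈ s, z ∈ K → f z - ε < φ z)
        ?_ ?_ ?_ ?_
      · obtain ⟨φ, hφ, h, -⟩ := hS x hx x hx
        exact ⟨φ, hφ, h, by simp⟩
      · rintro s t hst ⟨φ, hφ, h, h'⟩
        exact ⟨φ, hφ, h, fun z hz => h' z (hst hz)⟩
      · rintro s t ⟨φ, hφ, h, h'⟩ ⟨ψ, hψ, k, k'⟩
        refine ⟨φ ⊔ ψ, hsup φ hφ ψ hψ, by simp [h, k], ?_⟩
        rintro z (hz | hz) hzK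
        · exact lt_sup_of_lt_left (h' z hz hzK)
        · exact lt_sup_of_lt_right (k' z hz hzK)
      · intro y hy
        obtain ⟨φ, hφ, h, h'⟩ := hS x hx y hy
        have hc : ContinuousWithinAt (fun z => φ z - f z) K y :=
          φ.continuous.continuousWithinAt.sub (hf y hy)
        have hlt : ∀ᶠ z in 𝓝[K] y, -ε < φ z - f z :=
          hc.eventually (lt_mem_nhds (by simpa [h'] using hε))
        exact ⟨_, hlt, φ, hφ, h, fun z hz _ => by have : -ε < φ z - f z := hz; linarith⟩
    obtain ⟨φ, hφ, h, h'⟩ := key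
    exact ⟨φ, hφ, h, fun z hz => h' z hz hz⟩
  have key : ∃ φ ∈ S, (∀ z ∈ K, f z - ε < φ z) ∧ ∀ z ∈ K, z ∈ K → φ z < f z + ε := by
    refine hK.induction_on
      (p := fun s => ∃ φ ∈ S, (∀ z ∈ K, f z - ε < φ z) ∧ ∀ z ∈ s, z ∈ K → φ z < f z + ε) ?_ ?_ ?_ ?_
    · obtain ⟨φ, hφ, -, h⟩ := lower x₀ hx₀
      exact ⟨φ, hφ, h, by simp⟩
    · rintro s t hst ⟨φ, hφ, h, h'⟩
      exact ⟨φ, hφ, h, fun z hz => h' z (hst hz)⟩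
    · rintro s t ⟨φ, hφ, h, h'⟩ ⟨ψ, hψ, k, k'⟩
      refine ⟨φ ⊓ ψ, hinf φ hφ ψ hψ, fun z hz => lt_inf_iff.2 ⟨h z hz, k z hz⟩, ?_⟩
      rintro z (hz | hz) hzK
      · exact inf_lt_of_left_lt (h' z hz hzK)
      · exact inf_lt_of_right_lt (k' z hz hzK)
    · intro y hy
      obtain ⟨φ, hφ, h, h'⟩ := lower y hy
      have hc : ContinuousWithinAt (fun z => φ z - f z) K y :=
        φ.continuous.continuousWithinAt.sub (hf y hy)
      have hlt : ∀ᶠ z in 𝓝[K] y, φ z - f z < ε :=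
        hc.eventually (gt_mem_nhds (by simpa [h] using hε))
      exact ⟨_, hlt, φ, hφ, h', fun z hz _ => by have : φ z - f z < ε := hz; linarith⟩
  obtain ⟨φ, hφ, h, h'⟩ := key
  exact ⟨φ, hφ, fun x hx => abs_lt.2 ⟨by linarith [h x hx], by linarith [h' x hx hx]⟩⟩

variable {d : ExtDist X}

/-- The bounded continuous functions that are `L`-Lipschitz for `d`. -/
def ExtDist.boundedLip (d : ExtDist X) (L : ℝ≥0) : Set (X →ᵇ ℝ) := {φ | d.IsLip L φ}

/-- Two-point interpolation: if `d` is recovered from its `1`-Lipschitz functions, then an increment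
smaller than `L d(x, y)` is realised by an `L`-Lipschitz function. -/
lemma exists_isLip_interpolation
    (hd : ∀ x y, d.dist x y = ⨆ (f : LipB d) (_ : LipB.lipOn f Set.univ ≤ 1), edist (f.1 x) (f.1 y))
    {L : ℝ≥0} {x y : X} {s t : ℝ} (hst : s ≠ t → edist s t < L * d.dist x y) :
    ∃ φ ∈ d.boundedLip L, φ x = s ∧ φ y = t := by
  by_cases hs : s = t
  · subst hs
    exact ⟨BoundedContinuousFunction.const X s, ExtDist.IsLip.const d L s, rfl, rfl⟩
  have h := hst hs
  have hL : (L : ℝ≥0∞) ≠ 0 := by rintro h0; simp [h0] at h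
  rw [mul_comm, ← ENNReal.div_lt_iff (Or.inl hL) (Or.inl ENNReal.coe_ne_top), hd x y] at h
  simp only [lt_iSup_iff] at h
  obtain ⟨ψ, hψ, h⟩ := h
  rw [ENNReal.div_lt_iff (Or.inl hL) (Or.inl ENNReal.coe_ne_top)] at h
  have hψL : d.IsLip 1 ψ.1 := fun x y =>
    LipB.edist_le_of_lipOn_le one_pos (by simpa using hψ) (Set.mem_univ x) (Set.mem_univ y)
  -- the affine function of `ψ` with the values `s` and `t` at `x` and `y`
  have hlt : |s - t| < |ψ.1 x - ψ.1 y| * L := by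
    have : edist s t < ENNReal.ofReal (|ψ.1 x - ψ.1 y| * L) := by
      rw [ENNReal.ofReal_mul (abs_nonneg _), ← Real.dist_eq, ← edist_dist]
      simpa using h
    rw [edist_dist, Real.dist_eq] at this
    exact (ENNReal.ofReal_lt_ofReal_iff_of_nonneg (abs_nonneg _)).1 this
  have hne : ψ.1 x - ψ.1 y ≠ 0 := by
    intro h0
    rw [h0] at hlt
    simp at hlt
    exact absurd hlt (not_lt.2 (abs_nonneg _))
  set c : ℝ := (s - t) / (ψ.1 x - ψ.1 y) with hc
  have hcL : |c| ≤ L := by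
    rw [hc, abs_div, div_le_iff₀ (abs_pos.2 hne), mul_comm]
    exact hlt.le
  refine ⟨c • ψ.1 + BoundedContinuousFunction.const X (s - c * ψ.1 x), fun z w => ?_, ?_, ?_⟩
  · have e : edist ((c • ψ.1 + BoundedContinuousFunction.const X (s - c * ψ.1 x)) z)
        ((c • ψ.1 + BoundedContinuousFunction.const X (s - c * ψ.1 x)) w) =
        ‖c‖ₑ * edist (ψ.1 z) (ψ.1 w) := by
      rw [edist_eq_enorm_sub, edist_eq_enorm_sub, ← enorm_mul]
      congr 1
      simp
      ring
    rw [e]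
    have h1 : ‖c‖ₑ ≤ L := by
      rw [Real.enorm_eq_ofReal_abs]
      exact ENNReal.ofReal_le_of_le_toReal (by simpa using hcL)
    calc ‖c‖ₑ * edist (ψ.1 z) (ψ.1 w) ≤ L * (1 * d.dist z w) := by
          gcongr
          simpa using hψL z w
      _ = L * d.dist z w := by rw [one_mul]
  · simp
  · simp only [BoundedContinuousFunction.coe_add, BoundedContinuousFunction.coe_smul, Pi.add_apply,
      BoundedContinuousFunction.const_apply, smul_eq_mul]
    have : c * (ψ.1 x - ψ.1 y) = s - t := by rw [hc]; field_simp
    linarith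

lemma ExtDist.boundedLip_sup {L : ℝ≥0} {φ ψ : X →ᵇ ℝ} (hφ : φ ∈ d.boundedLip L)
    (hψ : ψ ∈ d.boundedLip L) : φ ⊔ ψ ∈ d.boundedLip L := ExtDist.IsLip.sup hφ hψ

lemma ExtDist.boundedLip_inf {L : ℝ≥0} {φ ψ : X →ᵇ ℝ} (hφ : φ ∈ d.boundedLip L)
    (hψ : ψ ∈ d.boundedLip L) : φ ⊓ ψ ∈ d.boundedLip L := ExtDist.IsLip.inf hφ hψ

/-- Extension from a compact set, with an arbitrarily small loss in the Lipschitz constant. The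
approximants of `f` on `K` are made uniformly Cauchy on the whole of `X` by clamping each of them
to a neighbourhood of the previous one: this changes nothing on `K`, and preserves the Lipschitz
constant because lattice operations do. -/
lemma LipB.exists_extension
    (hd : ∀ x y, d.dist x y = ⨆ (f : LipB d) (_ : LipB.lipOn f Set.univ ≤ 1), edist (f.1 x) (f.1 y))
    {K : Set X} (hK : IsCompact K) {f : X → ℝ} (hf : ContinuousOn f K) {L L' : ℝ≥0} (hLL' : L < L')
    (hfL : ∀ x ∈ K, ∀ y ∈ K, edist (f x) (f y) ≤ L * d.dist x y) :
    ∃ F : LipB d, d.IsLip L' F.1 ∧ ∀ x ∈ K, F.1 x = f x := by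
  have approx : ∀ ε : ℝ, 0 < ε → ∃ φ ∈ d.boundedLip L', ∀ x ∈ K, |φ x - f x| < ε := fun ε hε => by
    refine exists_forall_abs_sub_lt_of_lattice hK
      ⟨BoundedContinuousFunction.const X 0, ExtDist.IsLip.const d L' 0⟩
      (fun _ h _ k => ExtDist.boundedLip_sup h k) (fun _ h _ k => ExtDist.boundedLip_inf h k) hf
      (fun x hx y hy => ?_) hε
    refine exists_isLip_interpolation hd (fun hne => ?_)
    have hle := hfL x hx y hy
    have h0 : d.dist x y ≠ 0 := fun h0 => hne (by rw [(d.dist_eq_zero x y).1 h0])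
    by_cases ht : d.dist x y = ∞
    · rw [ht, ENNReal.mul_top (by exact_mod_cast (zero_le.trans_lt hLL').ne')]
      exact edist_lt_top _ _
    · refine hle.trans_lt ?_
      exact ENNReal.mul_lt_mul_left h0 ht (by exact_mod_cast hLL')
  choose! ψ hψL hψ using approx
  let ε : ℕ → ℝ := fun n => (1 / 2) ^ n
  have hε : ∀ n, 0 < ε n := fun n => by positivity
  let c : ℕ → X →ᵇ ℝ := fun n => BoundedContinuousFunction.const X (2 * ε n)
  let φ : ℕ → X →ᵇ ℝ := fun n =>
    Nat.rec (ψ (ε 0)) (fun n p => (p - c n) ⊔ (ψ (ε (n + 1)) ⊓ (p + c n))) n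
  have hφs : ∀ n, φ (n + 1) = (φ n - c n) ⊔ (ψ (ε (n + 1)) ⊓ (φ n + c n)) := fun n => rfl
  have hφL : ∀ n, φ n ∈ d.boundedLip L' := by
    intro n
    induction n with
    | zero => exact hψL _ (hε 0)
    | succ n ih =>
      rw [hφs]
      refine ExtDist.boundedLip_sup ?_ (ExtDist.boundedLip_inf (hψL _ (hε _)) ?_)
      · exact (ExtDist.IsLip.add_const ih (-(2 * ε n)) :)
      · exact ExtDist.IsLip.add_const ih (2 * ε n)
  have hφK : ∀ n, ∀ x ∈ K, |φ n x - f x| < ε n := by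
    intro n
    induction n with
    | zero => exact hψ _ (hε 0)
    | succ n ih =>
      intro x hx
      have h1 := abs_lt.1 (ih x hx)
      have h2 := abs_lt.1 (hψ _ (hε (n + 1)) x hx)
      have h3 : ε (n + 1) ≤ ε n := by
        simp only [ε, pow_succ]
        nlinarith [hε n]
      have e : φ (n + 1) x = ψ (ε (n + 1)) x := by
        change (φ n x - 2 * ε n) ⊔ (ψ (ε (n + 1)) x ⊓ (φ n x + 2 * ε n)) = _
        rw [inf_eq_left.2 (by linarith), sup_eq_right.2 (by linarith)]
      rw [e]
      exact abs_lt.2 h2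
  have hdist : ∀ n, dist (φ n) (φ (n + 1)) ≤ 2 * (1 / 2) ^ n := by
    intro n
    refine (BoundedContinuousFunction.dist_le (by positivity)).2 fun x => ?_
    have h := hε n
    change |φ n x - ((φ n x - 2 * ε n) ⊔ (ψ (ε (n + 1)) x ⊓ (φ n x + 2 * ε n)))| ≤ 2 * ε n
    refine abs_le.2 ⟨?_, ?_⟩
    · have : (φ n x - 2 * ε n) ⊔ (ψ (ε (n + 1)) x ⊓ (φ n x + 2 * ε n)) ≤ φ n x + 2 * ε n :=
        sup_le (by linarith) inf_le_right
      linarith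
    · have : φ n x - 2 * ε n ≤ (φ n x - 2 * ε n) ⊔ (ψ (ε (n + 1)) x ⊓ (φ n x + 2 * ε n)) :=
        le_sup_left
      linarith
  obtain ⟨F, hF⟩ := cauchySeq_tendsto_of_complete
    (cauchySeq_of_le_geometric (1 / 2) 2 (by norm_num) hdist)
  have hFx : ∀ x, Tendsto (fun n => φ n x) atTop (𝓝 (F x)) := fun x =>
    ((BoundedContinuousFunction.lipschitz_eval_const x).continuous.tendsto F).comp hF
  have hFL : d.IsLip L' F := ExtDist.IsLip.of_tendsto hφL hFx
  refine ⟨⟨F, L', hFL⟩, hFL, fun x hx => tendsto_nhds_unique (hFx x) ?_⟩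
  rw [tendsto_iff_dist_tendsto_zero]
  refine squeeze_zero (fun _ => dist_nonneg) (fun n => (hφK n x hx).le) ?_
  exact tendsto_pow_atTop_nhds_zero_of_lt_one (by norm_num) (by norm_num)

end Approximation

/-! ### Least elements of sets of bounds -/

section Bounds

variable {X : Type*} [MeasurableSpace X] {m : Measure X}

/-- The set of all `g ≥ 0` in `L⁰(m)` with `|F i| ≤ g w i` almost everywhere for each `i` has a
least element, as soon as it has an integrable element. The set is closed under countable infima, so a
minimising sequence for the integral yields an element of least integral, which is the least one
because the set is closed under binary infima. The index set may be uncountable. -/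
lemma exists_isLeast_bounds {ι : Type*} {F w : ι → X → ℝ} (hw : ∀ i x, 0 ≤ w i x)
    {g₀ : X →ₘ[m] ℝ} (hg₀ : 0 ≤ g₀) (hF : ∀ i, ∀ᵐ x ∂m, |F i x| ≤ g₀ x * w i x)
    (hint : Integrable g₀ m) :
    ∃ g, IsLeast {g : X →ₘ[m] ℝ | 0 ≤ g ∧ ∀ i, ∀ᵐ x ∂m, |F i x| ≤ g x * w i x} g := by
  set S := {g : X →ₘ[m] ℝ | 0 ≤ g ∧ ∀ i, ∀ᵐ x ∂m, |F i x| ≤ g x * w i x} with hS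
  have nonneg : ∀ {g : X →ₘ[m] ℝ}, 0 ≤ g → ∀ᵐ x ∂m, 0 ≤ g x := fun {g} hg => by
    filter_upwards [AEEqFun.coeFn_le.2 hg, AEEqFun.coeFn_zero (α := X) (β := ℝ) (μ := m)]
      with x h1 h2
    rw [h2] at h1
    exact h1
  set T : Set ℝ := {r | ∃ g ∈ S, Integrable g m ∧ ∫ x, g x ∂m = r} with hT
  have hTne : T.Nonempty := ⟨_, g₀, ⟨hg₀, hF⟩, hint, rfl⟩
  have hTb : BddBelow T := ⟨0, by
    rintro r ⟨g, hg, -, rfl⟩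
    exact integral_nonneg_of_ae (nonneg hg.1)⟩
  obtain ⟨u, -, hu, huT⟩ := exists_seq_tendsto_sInf hTne hTb
  choose s hsS hsi hsu using huT
  have hmeas : AEStronglyMeasurable (fun x => ⨅ n, s n x) m :=
    (AEMeasurable.iInf fun n => (s n).aestronglyMeasurable.aemeasurable).aestronglyMeasurable
  set g : X →ₘ[m] ℝ := AEEqFun.mk _ hmeas with hg
  have hgx : ∀ᵐ x ∂m, g x = ⨅ n, s n x := AEEqFun.coeFn_mk _ hmeas
  have hsn : ∀ᵐ x ∂m, ∀ n, 0 ≤ s n x := ae_all_iff.2 fun n => nonneg (hsS n).1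
  have hgn : ∀ᵐ x ∂m, 0 ≤ g x := by
    filter_upwards [hgx, hsn] with x h1 h2
    rw [h1]
    exact le_ciInf h2
  have hgle : ∀ n, ∀ᵐ x ∂m, g x ≤ s n x := fun n => by
    filter_upwards [hgx, hsn] with x h1 h2
    rw [h1]
    exact ciInf_le ⟨0, by rintro _ ⟨k, rfl⟩; exact h2 k⟩ n
  have hg0 : 0 ≤ g := by
    rw [← AEEqFun.coeFn_le]
    filter_upwards [hgn, AEEqFun.coeFn_zero (α := X) (β := ℝ) (μ := m)] with x h1 h2
    rw [h2]
    exact h1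
  have hgS : g ∈ S := by
    refine ⟨hg0, fun i => ?_⟩
    filter_upwards [hgx, ae_all_iff.2 fun n => (hsS n).2 i] with x h1 h2
    rw [h1, Real.iInf_mul_of_nonneg (hw i x)]
    exact le_ciInf h2
  have hgi : Integrable g m := (hsi 0).mono' g.aestronglyMeasurable (by
    filter_upwards [hgn, hgle 0] with x h1 h2
    rwa [Real.norm_eq_abs, abs_of_nonneg h1])
  have hgI : ∫ x, g x ∂m ≤ sInf T :=
    ge_of_tendsto' hu fun n => by
      rw [← hsu n]
      exact integral_mono_ae hgi (hsi n) (hgle n)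
  refine ⟨g, hgS, fun h hh => ?_⟩
  have hinf : ∀ᵐ x ∂m, (h ⊓ g : X →ₘ[m] ℝ) x = h x ⊓ g x := AEEqFun.coeFn_inf h g
  have hle : ∀ᵐ x ∂m, (h ⊓ g : X →ₘ[m] ℝ) x ≤ g x := AEEqFun.coeFn_le.2 inf_le_right
  have hkS : h ⊓ g ∈ S := by
    refine ⟨le_inf hh.1 hg0, fun i => ?_⟩
    filter_upwards [hinf, hh.2 i, hgS.2 i] with x h1 h2 h3
    rw [h1]
    rcases min_choice (h x) (g x) with h4 | h4 <;> rw [h4] <;> assumption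
  have hki : Integrable (h ⊓ g : X →ₘ[m] ℝ) m := hgi.mono' (AEEqFun.aestronglyMeasurable _) (by
    filter_upwards [hle, nonneg hkS.1] with x h1 h2
    rwa [Real.norm_eq_abs, abs_of_nonneg h2])
  have hkI : ∫ x, (h ⊓ g : X →ₘ[m] ℝ) x ∂m = ∫ x, g x ∂m :=
    le_antisymm (integral_mono_ae hki hgi hle) (hgI.trans (csInf_le hTb ⟨_, hkS, hki, rfl⟩))
  have heq := (integral_eq_iff_of_ae_le hki hgi hle).1 hkI
  rw [← inf_eq_right]
  exact AEEqFun.ext heq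

lemma essMeet_eq_of_isLeast {S : Set (X →ₘ[m] ℝ)} {g : X →ₘ[m] ℝ} (h : IsLeast S g) :
    essMeet S = g := by
  have hex : ∃ g, IsGLB S g := ⟨g, h.isGLB⟩
  rw [essMeet, dif_pos hex]
  exact hex.choose_spec.unique h.isGLB

lemma isLeast_essMeet {S : Set (X →ₘ[m] ℝ)} (h : ∃ g, IsLeast S g) : IsLeast S (essMeet S) := by
  obtain ⟨g, hg⟩ := h
  rwa [essMeet_eq_of_isLeast hg]

lemma mem_Lp_top_of_le {f g : X →ₘ[m] ℝ} (hf : 0 ≤ f) (hfg : f ≤ g)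
    (hg : g ∈ Lp ℝ ∞ m) : f ∈ Lp ℝ ∞ m := by
  rw [Lp.mem_Lp_iff_memLp] at hg ⊢
  refine hg.mono f.aestronglyMeasurable ?_
  filter_upwards [AEEqFun.coeFn_le.2 hf, AEEqFun.coeFn_zero (α := X) (β := ℝ) (μ := m),
    AEEqFun.coeFn_le.2 hfg] with x h1 h2 h3
  rw [h2] at h1
  have h1 : 0 ≤ f x := h1
  rw [Real.norm_eq_abs, Real.norm_eq_abs, abs_of_nonneg h1]
  exact h3.trans (le_abs_self _)

/-- An element of `L^∞` has a real almost everywhere bound. -/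
lemma exists_ae_abs_le {f : X →ₘ[m] ℝ} (hf : f ∈ Lp ℝ ∞ m) :
    ∃ C : ℝ, 0 ≤ C ∧ ∀ᵐ x ∂m, |f x| ≤ C := by
  rw [Lp.mem_Lp_iff_memLp] at hf
  refine ⟨(eLpNormEssSup f m).toReal, ENNReal.toReal_nonneg, ?_⟩
  have h := hf.2
  rw [eLpNorm_exponent_top] at h
  filter_upwards [ae_le_eLpNormEssSup (f := f) (μ := m)] with x hx
  have := ENNReal.toReal_mono h.ne hx
  simpa using this

lemma mem_Lp_top_of_ae_abs_le {f : X →ₘ[m] ℝ} {C : ℝ} (hf : ∀ᵐ x ∂m, |f x| ≤ C) : f ∈ Lp ℝ ∞ m := by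
  rw [Lp.mem_Lp_iff_memLp]
  exact memLp_top_of_bound f.aestronglyMeasurable C hf

end Bounds

namespace LipDer

variable {X : Type*} [TopologicalSpace X] [MeasurableSpace X] {d : ExtDist X} {m : Measure X}

lemma mem_normBounds_of_mem_slopeBounds {b : LipDer d m} {g : X →ₘ[m] ℝ} (hg : g ∈ b.slopeBounds)
    (hgL : g ∈ Lp ℝ ∞ m) : g ∈ b.normBounds := by
  refine ⟨hgL, hg.1, fun f => ?_⟩
  filter_upwards [hg.2 f, AEEqFun.coeFn_le.2 hg.1, AEEqFun.coeFn_zero (α := X) (β := ℝ) (μ := m)]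
    with x h1 h2 h3
  rw [h3] at h2
  exact h1.trans (mul_le_mul_of_nonneg_left (LipB.slope_le_lipNorm f x) h2)

variable [IsFiniteMeasure m]

lemma isLeast_absDM {b : LipDer d m} (hb : b ∈ DerQ d m ∞) : IsLeast b.slopeBounds b.absDM := by
  obtain ⟨g, hg, hgL⟩ := hb
  refine isLeast_essMeet (exists_isLeast_bounds (F := fun f : LipB d => b.op f)
    (w := fun f : LipB d => LipB.slope f) LipB.slope_nonneg hg.1 hg.2 ?_)
  exact ((Lp.mem_Lp_iff_memLp.1 hgL).integrable le_top)

lemma isLeast_absW {b : LipDer d m} (hb : b.normBounds.Nonempty) : IsLeast b.normBounds b.absW := by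
  obtain ⟨g, hgL, hg⟩ := hb
  obtain ⟨k, hk, hkl⟩ := exists_isLeast_bounds (F := fun f : LipB d => b.op f)
    (w := fun f : LipB d => fun _ => LipB.lipNorm f) (fun f _ => LipB.lipNorm_nonneg f) hg.1 hg.2
    ((Lp.mem_Lp_iff_memLp.1 hgL).integrable le_top)
  exact isLeast_essMeet ⟨k, ⟨mem_Lp_top_of_le hk.1 (hkl hg) hgL, hk⟩, fun h hh => hkl hh.2⟩

lemma absDM_mem_normBounds {b : LipDer d m} (hb : b ∈ DerQ d m ∞) : b.absDM ∈ b.normBounds := by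
  have h := isLeast_absDM hb
  obtain ⟨g, hg, hgL⟩ := hb
  exact mem_normBounds_of_mem_slopeBounds h.1 (mem_Lp_top_of_le h.1.1 (h.2 hg) hgL)

end LipDer

/-! ### Density of `Lip_b` in `L¹` -/

section Density

variable {X : Type*} [TopologicalSpace X] {d : ExtDist X}

/-- Disjoint compact sets are separated by an element of `Lip_b`: the indicator function of one of
them is continuous on their union, hence uniformly close there to an element of `Lip_b`. -/
lemma LipB.exists_cutoff [T2Space X]
    (hd : ∀ x y, d.dist x y = ⨆ (f : LipB d) (_ : LipB.lipOn f Set.univ ≤ 1), edist (f.1 x) (f.1 y))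
    {K C : Set X} (hK : IsCompact K) (hC : IsCompact C) (hKC : Disjoint K C) :
    ∃ φ : LipB d, (∀ x, φ.1 x ∈ Set.Icc (0 : ℝ) 1) ∧ (∀ x ∈ K, φ.1 x = 1) ∧ ∀ x ∈ C, φ.1 x = 0 := by
  classical
  set f : X → ℝ := K.indicator 1 with hf
  have hfK : ∀ x ∈ K, f x = 1 := fun x hx => by simp [hf, hx]
  have hfC : ∀ x ∈ C, f x = 0 := fun x hx => by
    simp [hf, Set.disjoint_right.1 hKC hx]
  have hcont : ContinuousOn f (K ∪ C) := by
    refine ContinuousOn.union_of_isClosed ?_ ?_ hK.isClosed hC.isClosed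
    · exact continuousOn_const.congr hfK
    · exact continuousOn_const.congr hfC
  obtain ⟨ψ, hψ, hψf⟩ : ∃ ψ ∈ LipB d, ∀ x ∈ K ∪ C, |ψ x - f x| < 1 / 4 := by
    refine exists_forall_abs_sub_lt_of_lattice (hK.union hC)
      (S := {φ | φ ∈ LipB d}) ⟨_, const_mem 0⟩ (fun _ h _ k => sup_mem h k)
      (fun _ h _ k => inf_mem h k) hcont (fun x _ y _ => ?_) (by norm_num)
    -- an element of `Lip_b` that separates `x` and `y` interpolates any two values there
    by_cases hxy : x = y
    · subst hxy
      exact ⟨_, const_mem (f x), rfl, rfl⟩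
    have h0 : 0 < d.dist x y := pos_iff_ne_zero.2 fun h0 => hxy ((d.dist_eq_zero x y).1 h0)
    obtain ⟨L, hL⟩ : ∃ L : ℝ≥0, f x ≠ f y → edist (f x) (f y) < L * d.dist x y := by
      by_cases ht : d.dist x y = ∞
      · exact ⟨1, fun _ => by simp [ht, edist_lt_top]⟩
      · obtain ⟨L, hL⟩ := ENNReal.exists_nnreal_pos_mul_lt
            (a := edist (f x) (f y)) (b := d.dist x y)
          (edist_ne_top _ _) h0.ne'
        refine ⟨L⁻¹, fun _ => ?_⟩
        rw [ENNReal.coe_inv hL.1.ne', mul_comm, ← div_eq_mul_inv]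
        rw [ENNReal.lt_div_iff_mul_lt (Or.inl (by exact_mod_cast hL.1.ne'))
          (Or.inl ENNReal.coe_ne_top), mul_comm]
        exact hL.2
    obtain ⟨φ, hφ, h1, h2⟩ := exists_isLip_interpolation hd hL
    exact ⟨φ, ⟨L, hφ⟩, h1, h2⟩
  set c : ℝ → X →ᵇ ℝ := BoundedContinuousFunction.const X
  set φ : X →ᵇ ℝ := c 0 ⊔ (c 1 ⊓ ((2 : ℝ) • ψ - c (1 / 2))) with hφ
  have hφx : ∀ x, φ x = 0 ⊔ (1 ⊓ (2 * ψ x - 1 / 2)) := fun x => rfl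
  refine ⟨⟨φ, sup_mem (const_mem 0) (inf_mem (const_mem 1)
    (sub_mem (Subalgebra.smul_mem _ hψ 2) (const_mem _)))⟩, fun x => ?_, fun x hx => ?_,
    fun x hx => ?_⟩
  · exact ⟨le_sup_left, sup_le zero_le_one inf_le_left⟩
  · have h := abs_lt.1 (hψf x (Or.inl hx))
    rw [hfK x hx] at h
    change φ x = 1
    rw [hφx, inf_eq_left.2 (by linarith), sup_eq_right.2 zero_le_one]
  · have h := abs_lt.1 (hψf x (Or.inr hx))
    rw [hfC x hx] at h
    change φ x = 0
    rw [hφx, inf_eq_right.2 (by linarith), sup_eq_left.2 (by linarith)]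

variable [MeasurableSpace X] {m : Measure X}

lemma LipB.integrable [BorelSpace X] [IsFiniteMeasure m] (f : LipB d) : Integrable f.1 m :=
  BoundedContinuousFunction.integrable m f.1

/-- `Lip_b` is dense in `L¹(m)`. -/
lemma IsEMTMSpace.exists_integral_abs_sub_le (hX : IsEMTMSpace d m) {h : X → ℝ}
    (hh : Integrable h m) {ε : ℝ} (hε : 0 < ε) : ∃ φ : LipB d, ∫ x, |h x - φ.1 x| ∂m ≤ ε := by
  have := hX.hausdorff
  have := hX.borel
  have := hX.finite
  have := hX.radon
  obtain ⟨g, hg, φ, rfl⟩ : ∃ g : X → ℝ, eLpNorm (h - g) 1 m ≤ ENNReal.ofReal ε ∧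
      ∃ φ : LipB d, ⇑φ.1 = g := by
    refine MemLp.induction_dense ENNReal.one_ne_top (fun g : X → ℝ => ∃ φ : LipB d, ⇑φ.1 = g)
      ?_ ?_ ?_ (memLp_one_iff_integrable.2 hh) (by simpa using hε)
    · intro c s hs _ ε hε
      set η : ℝ≥0∞ := ε / 2 / ‖c‖ₑ with hη
      have hη0 : η ≠ 0 := by simp [hη, ENNReal.div_eq_zero_iff, hε]
      obtain ⟨K, hKs, hK, hmK⟩ := hs.exists_isCompact_sdiff_lt (measure_ne_top m s) hη0
      obtain ⟨C, hCs, hC, hmC⟩ := hs.compl.exists_isCompact_sdiff_lt (measure_ne_top m _) hη0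
      obtain ⟨φ, hφ, hφK, hφC⟩ := LipB.exists_cutoff hX.recovery hK hC
        (disjoint_compl_right.mono hKs hCs)
      refine ⟨_, ?_, c • φ, rfl⟩
      rw [eLpNorm_one_eq_lintegral_enorm]
      have hms : MeasurableSet ((s \ K) ∪ (sᶜ \ C)) :=
        (hs.diff hK.measurableSet).union (hs.compl.diff hC.measurableSet)
      have hpt : ∀ x, ‖((c • φ : LipB d).1 - s.indicator fun _ => c : X → ℝ) x‖ₑ ≤
          ((s \ K) ∪ (sᶜ \ C)).indicator (fun _ => ‖c‖ₑ) x := by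
        intro x
        have e : ((c • φ : LipB d).1 - s.indicator fun _ => c : X → ℝ) x =
            c * (φ.1 x - s.indicator 1 x) := by
          by_cases hx : x ∈ s
          · simp [hx, mul_sub]
          · simp [hx]
        rw [e, enorm_mul]
        have h01 := hφ x
        by_cases hx : x ∈ s
        · by_cases hxK : x ∈ K
          · simp [hx, hφK x hxK]
          · have : x ∈ (s \ K) ∪ (sᶜ \ C) := Or.inl ⟨hx, hxK⟩
            rw [Set.indicator_of_mem this]
            refine mul_le_of_le_one_right' ?_
            rw [Real.enorm_eq_ofReal_abs]
            refine ENNReal.ofReal_le_one.2 (abs_le.2 ?_)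
            simp only [hx, Set.indicator_of_mem, Pi.one_apply]
            constructor <;> linarith [h01.1, h01.2]
        · by_cases hxC : x ∈ C
          · simp [hx, hφC x hxC]
          · have : x ∈ (s \ K) ∪ (sᶜ \ C) := Or.inr ⟨hx, hxC⟩
            rw [Set.indicator_of_mem this]
            refine mul_le_of_le_one_right' ?_
            rw [Real.enorm_eq_ofReal_abs]
            refine ENNReal.ofReal_le_one.2 (abs_le.2 ?_)
            simp only [hx, not_false_eq_true, Set.indicator_of_notMem]
            constructor <;> linarith [h01.1, h01.2]
      calc ∫⁻ x, ‖((c • φ : LipB d).1 - s.indicator fun _ => c : X → ℝ) x‖ₑ ∂m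
          ≤ ∫⁻ x, ((s \ K) ∪ (sᶜ \ C)).indicator (fun _ => ‖c‖ₑ) x ∂m := lintegral_mono hpt
        _ = ‖c‖ₑ * m ((s \ K) ∪ (sᶜ \ C)) := lintegral_indicator_const hms _
        _ ≤ ‖c‖ₑ * (η + η) := by
            gcongr
            exact (measure_union_le _ _).trans (add_le_add hmK.le hmC.le)
        _ = η * ‖c‖ₑ + η * ‖c‖ₑ := by ring
        _ ≤ ε / 2 + ε / 2 := by
            gcongr <;> exact (mul_comm _ _).trans_le ENNReal.mul_div_le
        _ = ε := ENNReal.add_halves ε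
    · rintro _ _ ⟨φ, rfl⟩ ⟨ψ, rfl⟩
      exact ⟨φ + ψ, rfl⟩
    · rintro _ ⟨φ, rfl⟩
      exact (LipB.integrable (m := m) φ).aestronglyMeasurable
  refine ⟨φ, ?_⟩
  have e := integral_norm_eq_lintegral_enorm (μ := m)
    (hh.sub (LipB.integrable (m := m) φ)).aestronglyMeasurable
  rw [eLpNorm_one_eq_lintegral_enorm] at hg
  have := ENNReal.toReal_mono ENNReal.ofReal_ne_top hg
  rw [← e, ENNReal.toReal_ofReal hε.le] at this
  exact this

/-- A bounded sequence in `L^∞(m)` that converges against `Lip_b` converges weakly-star. -/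
lemma IsEMTMSpace.tendsto_integral_mul (hX : IsEMTMSpace d m) {w : ℕ → X → ℝ} {v : X → ℝ} {C : ℝ}
    (hw : ∀ n, AEStronglyMeasurable (w n) m) (hv : AEStronglyMeasurable v m)
    (hwC : ∀ n, ∀ᵐ x ∂m, |w n x| ≤ C) (hvC : ∀ᵐ x ∂m, |v x| ≤ C)
    (hφ : ∀ φ : LipB d, Tendsto (fun n => ∫ x, φ.1 x * w n x ∂m) atTop (𝓝 (∫ x, φ.1 x * v x ∂m)))
    {h : X → ℝ} (hh : Integrable h m) :
    Tendsto (fun n => ∫ x, h x * w n x ∂m) atTop (𝓝 (∫ x, h x * v x ∂m)) := by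
  have := hX.borel
  have := hX.finite
  have mulInt : ∀ {k u : X → ℝ}, Integrable k m → AEStronglyMeasurable u m →
      (∀ᵐ x ∂m, |u x| ≤ C) → Integrable (fun x => k x * u x) m := fun hk hu huC =>
    hk.mul_bdd hu huC
  rcases le_or_gt C 0 with hC | hC
  · have zero : ∀ u : X → ℝ, (∀ᵐ x ∂m, |u x| ≤ C) → ∫ x, h x * u x ∂m = 0 := fun u hu => by
      refine integral_eq_zero_of_ae ?_
      filter_upwards [hu] with x hx
      simp [abs_nonpos_iff.1 (hx.trans hC)]
    simp only [zero _ (hwC _), zero _ hvC]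
    exact tendsto_const_nhds
  have diff : ∀ (φ : LipB d) (u : X → ℝ), AEStronglyMeasurable u m → (∀ᵐ x ∂m, |u x| ≤ C) →
      |∫ x, h x * u x ∂m - ∫ x, φ.1 x * u x ∂m| ≤ (∫ x, |h x - φ.1 x| ∂m) * C := by
    intro φ u hu huC
    have hφi := LipB.integrable (m := m) φ
    rw [← integral_sub (mulInt hh hu huC) (mulInt hφi hu huC), ← integral_mul_const]
    refine (abs_integral_le_integral_abs).trans ?_
    refine integral_mono_ae ((mulInt hh hu huC).sub (mulInt hφi hu huC)).abs
      ((hh.sub hφi).abs.mul_const C) ?_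
    filter_upwards [huC] with x hx
    change |h x * u x - φ.1 x * u x| ≤ |h x - φ.1 x| * C
    rw [← sub_mul, abs_mul]
    gcongr
  rw [Metric.tendsto_atTop]
  intro ε hε
  obtain ⟨φ, hφh⟩ := hX.exists_integral_abs_sub_le hh (ε := ε / (4 * C)) (by positivity)
  have hsmall : (∫ x, |h x - φ.1 x| ∂m) * C ≤ ε / 4 := by
    calc (∫ x, |h x - φ.1 x| ∂m) * C ≤ ε / (4 * C) * C := by gcongr
      _ = ε / 4 := by field_simp
  obtain ⟨N, hN⟩ := Metric.tendsto_atTop.1 (hφ φ) (ε / 4) (by positivity)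
  refine ⟨N, fun n hn => ?_⟩
  have h1 := abs_le.1 (diff φ (w n) (hw n) (hwC n))
  have h2 := abs_le.1 (diff φ v hv hvC)
  have h3 := hN n hn
  rw [Real.dist_eq] at h3 ⊢
  have h3 := abs_lt.1 h3
  exact abs_lt.2 ⟨by linarith [h1.1, h2.2, h3.1], by linarith [h1.2, h2.1, h3.2]⟩

end Density

/-! ### Di Marino derivations with divergence -/

/-- Against `h ∈ Lip_b`, the Leibniz rule and the divergence move the derivation from the sequence
to `h`, where dominated convergence applies; a bound in `L^∞` and the density of `Lip_b` in `L¹`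
do the rest. -/
lemma derQR_top_one_subset_weaverDer {X : Type*} [TopologicalSpace X] [MeasurableSpace X]
    {d : ExtDist X} {m : Measure X} (hX : IsEMTMSpace d m) : DerQR d m ∞ 1 ⊆ WeaverDer d m := by
  have := hX.borel
  have := hX.finite
  rintro b ⟨⟨g, hg, hgL⟩, δ, ⟨hbi, hδ, hdiv⟩, -⟩
  have hgN := LipDer.mem_normBounds_of_mem_slopeBounds hg hgL
  obtain ⟨C, hC, hgC⟩ := exists_ae_abs_le hgL
  have bound : ∀ f : LipB d, ∀ᵐ x ∂m, |b.op f x| ≤ C * LipB.lipNorm f := fun f => by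
    filter_upwards [hgN.2.2 f, hgC] with x h1 h2
    exact h1.trans (mul_le_mul_of_nonneg_right ((le_abs_self _).trans h2) (LipB.lipNorm_nonneg f))
  refine ⟨fun f => mem_Lp_top_of_ae_abs_le (bound f), fun u f hu hf huf h hh => ?_⟩
  have bound1 : ∀ f : LipB d, LipB.lipNorm f ≤ 1 → ∀ᵐ x ∂m, |b.op f x| ≤ C := fun f hf => by
    filter_upwards [bound f] with x h1
    exact h1.trans (mul_le_of_le_one_right hC hf)
  refine hX.tendsto_integral_mul (fun n => (b.op (u n)).aestronglyMeasurable)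
    (b.op f).aestronglyMeasurable (fun n => bound1 _ (hu n)) (bound1 f hf) (fun φ => ?_) hh
  -- integration by parts
  have parts : ∀ k : LipB d, ∫ x, φ.1 x * b.op k x ∂m =
      -∫ x, k.1 x * (φ.1 x * δ x + b.op φ x) ∂m := by
    intro k
    have i1 : Integrable (fun x => φ.1 x * b.op k x) m :=
      (hbi k).bdd_mul φ.1.continuous.aestronglyMeasurable (ae_of_all _ φ.1.norm_coe_le_norm)
    have i2 : Integrable (fun x => k.1 x * b.op φ x) m :=
      (hbi φ).bdd_mul k.1.continuous.aestronglyMeasurable (ae_of_all _ k.1.norm_coe_le_norm)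
    have i3 : Integrable (fun x => (φ * k).1 x * δ x) m :=
      hδ.bdd_mul (φ * k).1.continuous.aestronglyMeasurable
        (ae_of_all _ (φ * k).1.norm_coe_le_norm)
    have e1 : ∫ x, b.op (φ * k) x ∂m = ∫ x, φ.1 x * b.op k x ∂m + ∫ x, k.1 x * b.op φ x ∂m := by
      rw [← integral_add i1 i2]
      exact integral_congr_ae (b.leibniz φ k)
    have e2 : ∫ x, k.1 x * (φ.1 x * δ x + b.op φ x) ∂m =
        ∫ x, (φ * k).1 x * δ x ∂m + ∫ x, k.1 x * b.op φ x ∂m := by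
      rw [← integral_add i3 i2]
      refine integral_congr_ae (ae_of_all _ fun x => ?_)
      change k.1 x * (φ.1 x * δ x + b.op φ x) = φ.1 x * k.1 x * δ x + k.1 x * b.op φ x
      ring
    linarith [hdiv (φ * k)]
  simp only [parts]
  have hint : Integrable (fun x => φ.1 x * δ x + b.op φ x) m :=
    (hδ.bdd_mul φ.1.continuous.aestronglyMeasurable (ae_of_all _ φ.1.norm_coe_le_norm)).add (hbi φ)
  refine Tendsto.neg (tendsto_integral_of_dominated_convergence
    (fun x => |φ.1 x * δ x + b.op φ x|) (fun n => ?_) hint.abs (fun n => ?_) ?_)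
  · exact (u n).1.continuous.aestronglyMeasurable.mul hint.aestronglyMeasurable
  · refine ae_of_all _ fun x => ?_
    rw [Real.norm_eq_abs, abs_mul]
    exact mul_le_of_le_one_left (abs_nonneg _) ((LipB.abs_le_lipNorm _ x).trans (hu n))
  · exact ae_of_all _ fun x => (huf x).mul_const _

/-! ### Weaver derivations are bounded and local -/

/-- A pointwise bounded sequence of functionals on `L¹(m)`, given by functions of `L^∞(m)`, is
bounded, by the Banach–Steinhaus theorem. -/
lemma exists_ae_abs_le_of_tendsto {X : Type*} [MeasurableSpace X] {m : Measure X}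
    [IsFiniteMeasure m] {w : ℕ → X →ₘ[m] ℝ} (hw : ∀ n, w n ∈ Lp ℝ ∞ m)
    {l : (X → ℝ) → ℝ}
    (hl : ∀ h : X → ℝ, Integrable h m → Tendsto (fun n => ∫ x, h x * w n x ∂m) atTop (𝓝 (l h))) :
    ∃ C : ℝ, ∀ n, ∀ᵐ x ∂m, |w n x| ≤ C := by
  choose c hc0 hc using fun n => exists_ae_abs_le (hw n)
  have mulInt : ∀ n {k : X → ℝ}, Integrable k m → Integrable (fun x => k x * w n x) m :=
    fun n k hk => hk.mul_bdd (w n).aestronglyMeasurable (hc n)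
  let T : ℕ → Lp ℝ 1 m →L[ℝ] ℝ := fun n => LinearMap.mkContinuous
    { toFun := fun h => ∫ x, h x * w n x ∂m
      map_add' := fun h k => by
        rw [← integral_add (mulInt n (L1.integrable_coeFn h)) (mulInt n (L1.integrable_coeFn k))]
        refine integral_congr_ae ?_
        filter_upwards [Lp.coeFn_add h k] with x hx
        rw [hx, Pi.add_apply, add_mul]
      map_smul' := fun r h => by
        rw [RingHom.id_apply, smul_eq_mul, ← integral_const_mul]
        refine integral_congr_ae ?_
        filter_upwards [Lp.coeFn_smul r h] with x hx
        rw [hx, Pi.smul_apply, smul_eq_mul, mul_assoc] } (c n) (fun h => by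
      change |∫ x, h x * w n x ∂m| ≤ c n * ‖h‖
      rw [L1.norm_eq_integral_norm, ← integral_const_mul]
      refine abs_integral_le_integral_abs.trans (integral_mono_ae
        (mulInt n (L1.integrable_coeFn h)).abs ((L1.integrable_coeFn h).norm.const_mul _) ?_)
      filter_upwards [hc n] with x hx
      rw [abs_mul, mul_comm, Real.norm_eq_abs]
      gcongr)
  obtain ⟨C, hC⟩ := banach_steinhaus (g := T) fun h => by
    obtain ⟨M, hM⟩ := (hl h (L1.integrable_coeFn h)).norm.bddAbove_range
    exact ⟨M, fun n => hM ⟨n, rfl⟩⟩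
  refine ⟨C, fun n => ?_⟩
  have hwi : Integrable (w n) m := (Lp.mem_Lp_iff_memLp.1 (hw n)).integrable le_top
  have set_le : ∀ s, MeasurableSet s → |∫ x in s, w n x ∂m| ≤ C * m.real s := by
    intro s hs
    have h1 := (T n).le_opNorm (indicatorConstLp 1 hs (measure_ne_top m s) (1 : ℝ))
    rw [norm_indicatorConstLp one_ne_zero ENNReal.one_ne_top] at h1
    have e : T n (indicatorConstLp 1 hs (measure_ne_top m s) (1 : ℝ)) = ∫ x in s, w n x ∂m := by
      rw [← integral_indicator hs]
      refine integral_congr_ae ?_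
      filter_upwards [indicatorConstLp_coeFn (p := 1) (hs := hs) (hμs := measure_ne_top m s)
        (c := (1 : ℝ))] with x hx
      rw [hx]
      by_cases hxs : x ∈ s <;> simp [hxs]
    rw [e] at h1
    simp only [norm_one, ENNReal.toReal_one, div_one, Real.rpow_one, one_mul,
      Real.norm_eq_abs] at h1
    exact h1.trans (by gcongr; exact hC n)
  have up : w n ≤ᵐ[m] fun _ => C :=
    ae_le_of_forall_setIntegral_le hwi (integrable_const C) fun s hs _ => by
      rw [setIntegral_const, smul_eq_mul, mul_comm]
      exact (le_abs_self _).trans (set_le s hs)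
  have down : (fun x => -w n x) ≤ᵐ[m] fun _ => C :=
    ae_le_of_forall_setIntegral_le hwi.neg (integrable_const C) fun s hs _ => by
      rw [setIntegral_const, smul_eq_mul, mul_comm, integral_neg]
      exact (neg_le_abs _).trans (set_le s hs)
  filter_upwards [up, down] with x h1 h2
  exact abs_le.2 ⟨by linarith, h1⟩

section Weaver

variable {X : Type*} [TopologicalSpace X] [MeasurableSpace X] {d : ExtDist X} {m : Measure X}

lemma LipDer.op_smul_ae (b : LipDer d m) (c : ℝ) (f : LipB d) :
    ∀ᵐ x ∂m, b.op (c • f) x = c * b.op f x := by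
  rw [map_smul]
  exact AEEqFun.coeFn_smul c (b.op f)

lemma LipDer.op_sub_ae (b : LipDer d m) (f g : LipB d) :
    ∀ᵐ x ∂m, b.op (f - g) x = b.op f x - b.op g x := by
  have h : b.op (f - g) = b.op f - b.op g := by
    rw [eq_sub_iff_add_eq, ← map_add]
    exact congrArg b.op (Subtype.ext (sub_add_cancel f.1 g.1))
  rw [h]
  exact AEEqFun.coeFn_sub (b.op f) (b.op g)

lemma LipDer.op_zero_ae (b : LipDer d m) : ∀ᵐ x ∂m, b.op 0 x = 0 := by
  rw [map_zero]
  exact AEEqFun.coeFn_zero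

lemma LipDer.op_one_ae (b : LipDer d m) : ∀ᵐ x ∂m, b.op 1 x = 0 := by
  filter_upwards [b.leibniz 1 1] with x hx
  rw [one_mul] at hx
  change b.op 1 x = 1 * b.op 1 x + 1 * b.op 1 x at hx
  linarith

/-- The continuity of a Weaver derivation holds along every sequence that is bounded for the norm of
`Lip_b`, by homogeneity. -/
lemma WeaverDer.tendsto {b : LipDer d m} (hb : b ∈ WeaverDer d m) {R : ℝ} (hR : 0 < R)
    {u : ℕ → LipB d} {f : LipB d} (hu : ∀ n, LipB.lipNorm (u n) ≤ R) (hf : LipB.lipNorm f ≤ R)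
    (huf : ∀ x, Tendsto (fun n => (u n).1 x) atTop (𝓝 (f.1 x))) {h : X → ℝ} (hh : Integrable h m) :
    Tendsto (fun n => ∫ x, h x * b.op (u n) x ∂m) atTop (𝓝 (∫ x, h x * b.op f x ∂m)) := by
  have hle : ∀ k : LipB d, LipB.lipNorm k ≤ R → LipB.lipNorm (R⁻¹ • k) ≤ 1 := fun k hk => by
    refine (LipB.lipNorm_smul_le _ _).trans ?_
    rw [abs_of_pos (inv_pos.2 hR), inv_mul_le_iff₀ hR, mul_one]
    exact hk
  have key := (hb.2 (fun n => R⁻¹ • u n) (R⁻¹ • f) (fun n => hle _ (hu n)) (hle _ hf)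
    (fun x => (huf x).const_mul R⁻¹) h hh).const_mul R
  have e : ∀ k : LipB d, R * ∫ x, h x * b.op (R⁻¹ • k) x ∂m = ∫ x, h x * b.op k x ∂m := fun k => by
    rw [← integral_const_mul]
    refine integral_congr_ae ?_
    filter_upwards [b.op_smul_ae R⁻¹ k] with x hx
    rw [hx]
    field_simp
  simpa only [e] using key

variable [IsFiniteMeasure m]

/-- A Weaver derivation is bounded from `Lip_b` to `L^∞(m)`. Otherwise some `f n` in the unit ball
has `‖b (f n)‖ > (n + 1)²`; then `f n / (n + 1)` tends to `0` pointwise in the unit ball, and its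
images are unbounded although they converge weakly-star. -/
lemma WeaverDer.exists_bound {b : LipDer d m} (hb : b ∈ WeaverDer d m) :
    ∃ C : ℝ, 0 ≤ C ∧ ∀ f : LipB d, LipB.lipNorm f ≤ 1 → ∀ᵐ x ∂m, |b.op f x| ≤ C := by
  by_contra! hcon
  choose f hf hfb using fun n : ℕ => hcon (((n : ℝ) + 1) * (n + 1)) (by positivity)
  set v : ℕ → LipB d := fun n => ((n : ℝ) + 1)⁻¹ • f n with hv
  have hpos : ∀ n : ℕ, 0 < (n : ℝ) + 1 := fun n => by positivity
  have hv1 : ∀ n, LipB.lipNorm (v n) ≤ 1 := fun n => by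
    refine (LipB.lipNorm_smul_le _ _).trans ?_
    rw [abs_of_pos (inv_pos.2 (hpos n)), inv_mul_le_iff₀ (hpos n)]
    exact (hf n).trans (by simp)
  have hv0 : ∀ x, Tendsto (fun n => (v n).1 x) atTop (𝓝 ((0 : LipB d).1 x)) := fun x => by
    refine squeeze_zero_norm (fun n => ?_) (tendsto_one_div_add_atTop_nhds_zero_nat (𝕜 := ℝ))
    change |((n : ℝ) + 1)⁻¹ * (f n).1 x| ≤ 1 / ((n : ℝ) + 1)
    rw [abs_mul, abs_of_pos (inv_pos.2 (hpos n)), one_div]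
    exact mul_le_of_le_one_right (inv_pos.2 (hpos n)).le ((LipB.abs_le_lipNorm _ x).trans (hf n))
  have h0 : LipB.lipNorm (0 : LipB d) ≤ 1 := by
    have := LipB.lipNorm_smul_le (0 : ℝ) (0 : LipB d)
    rw [abs_zero, zero_mul, smul_zero] at this
    linarith
  obtain ⟨C, hC⟩ := exists_ae_abs_le_of_tendsto (w := fun n => b.op (v n)) (fun n => hb.1 _)
    (fun h hh => hb.2 v 0 hv1 h0 hv0 h hh)
  obtain ⟨n, hn⟩ := exists_nat_ge C
  refine hfb n ?_
  filter_upwards [hC n, b.op_smul_ae ((n : ℝ) + 1)⁻¹ (f n)] with x h1 h2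
  rw [h2, abs_mul, abs_of_pos (inv_pos.2 (hpos n)), inv_mul_le_iff₀ (hpos n)] at h1
  refine not_lt.2 (h1.trans ?_)
  have := hpos n
  gcongr
  linarith

lemma WeaverDer.normBounds_nonempty {b : LipDer d m} (hb : b ∈ WeaverDer d m) :
    b.normBounds.Nonempty := by
  obtain ⟨C, hC, hbC⟩ := WeaverDer.exists_bound hb
  have hc : ∀ᵐ x ∂m, (AEEqFun.const X C : X →ₘ[m] ℝ) x = C := AEEqFun.coeFn_const X C
  refine ⟨AEEqFun.const X C, mem_Lp_top_of_ae_abs_le (C := |C|) (hc.mono fun x hx => by rw [hx]),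
    ?_, fun f => ?_⟩
  · rw [← AEEqFun.coeFn_le]
    filter_upwards [hc, AEEqFun.coeFn_zero (α := X) (β := ℝ) (μ := m)] with x h1 h2
    rw [h1, h2]
    exact hC
  · rcases (LipB.lipNorm_nonneg f).eq_or_lt with h0 | hpos
    · have hf0 : f = 0 := by
        ext x
        exact abs_nonpos_iff.1 ((LipB.abs_le_lipNorm f x).trans h0.ge)
      subst hf0
      filter_upwards [b.op_zero_ae] with x hx
      rw [hx, ← h0]
      simp
    · have h1 : LipB.lipNorm ((LipB.lipNorm f)⁻¹ • f) ≤ 1 := by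
        refine (LipB.lipNorm_smul_le _ _).trans ?_
        rw [abs_of_pos (inv_pos.2 hpos), inv_mul_cancel₀ hpos.ne']
      filter_upwards [hbC _ h1, hc, b.op_smul_ae (LipB.lipNorm f)⁻¹ f] with x h2 h3 h4
      rw [h4, abs_mul, abs_of_pos (inv_pos.2 hpos), inv_mul_le_iff₀ hpos, mul_comm] at h2
      rwa [h3]

/-- Locality of Weaver derivations on zero sets. The function `f` is the bounded pointwise limit of
functions `u n` that vanish for `|f| ≤ 1 / (n + 1)`, so that `u n = u n * χ n` with
`χ n = min 1 ((n + 1) |f|)`. Both factors vanish on `{f = 0}`, and so does `b (u n)` by the Leibniz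
rule. -/
lemma WeaverDer.ae_eq_zero_of_eq_zero [BorelSpace X] {b : LipDer d m} (hb : b ∈ WeaverDer d m)
    (f : LipB d) : ∀ᵐ x ∂m, f.1 x = 0 → b.op f x = 0 := by
  set c : ℝ → X →ᵇ ℝ := BoundedContinuousFunction.const X with hc
  have hcm : ∀ r, c r ∈ LipB d := LipB.const_mem
  set ε : ℕ → ℝ := fun n => 1 / ((n : ℝ) + 1) with hε
  have hεpos : ∀ n, 0 < ε n := fun n => by positivity
  obtain ⟨L, hL⟩ := f.2
  set u : ℕ → LipB d := fun n => ⟨(f.1 - c (ε n)) ⊔ ((f.1 + c (ε n)) ⊓ c 0),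
    LipB.sup_mem (sub_mem f.2 (hcm _)) (LipB.inf_mem (add_mem f.2 (hcm _)) (hcm _))⟩ with hu
  set χ : ℕ → LipB d := fun n => ⟨c 1 ⊓ (((n : ℝ) + 1) • (f.1 ⊔ -f.1)),
    LipB.inf_mem (hcm _) (Subalgebra.smul_mem _ (LipB.sup_mem f.2 (neg_mem f.2)) _)⟩ with hχ
  have hux : ∀ n x, (u n).1 x = (f.1 x - ε n) ⊔ ((f.1 x + ε n) ⊓ 0) := fun n x => rfl
  have hχx : ∀ n x, (χ n).1 x = 1 ⊓ (((n : ℝ) + 1) * |f.1 x|) := fun n x => rfl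
  have hu0 : ∀ n x, |f.1 x| ≤ ε n → (u n).1 x = 0 := fun n x h => by
    have h := abs_le.1 h
    rw [hux, inf_eq_right.2 (by linarith), sup_eq_right.2 (by linarith)]
  have huclose : ∀ n x, |(u n).1 x - f.1 x| ≤ ε n := fun n x => by
    have := hεpos n
    rw [hux]
    rcases le_total (f.1 x + ε n) 0 with h | h
    · rw [inf_eq_left.2 h, sup_eq_right.2 (by linarith)]
      simp [abs_of_pos this]
    · rw [inf_eq_right.2 h]
      rcases le_total (f.1 x - ε n) 0 with h' | h'
      · rw [sup_eq_right.2 h']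
        exact abs_le.2 ⟨by linarith, by linarith⟩
      · rw [sup_eq_left.2 h']
        exact abs_le.2 ⟨by linarith, by linarith⟩
  have hule : ∀ n x, |(u n).1 x| ≤ ‖f.1‖ := fun n x => by
    have := hεpos n
    have hfx := abs_le.1 (f.1.norm_coe_le_norm x)
    rw [hux]
    refine abs_le.2 ⟨?_, sup_le (by linarith) (inf_le_right.trans (norm_nonneg _))⟩
    refine le_sup_of_le_right (le_inf (by linarith) ?_)
    have := norm_nonneg f.1
    linarith
  have huχ : ∀ n, u n = u n * χ n := fun n => by
    ext x
    change (u n).1 x = (u n).1 x * (χ n).1 x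
    rcases le_or_gt |f.1 x| (ε n) with h | h
    · rw [hu0 n x h, zero_mul]
    · have : 1 ≤ ((n : ℝ) + 1) * |f.1 x| := by
        rw [hε, div_lt_iff₀ (by positivity)] at h
        linarith
      rw [hχx, inf_eq_left.2 this, mul_one]
  have hbu : ∀ n, ∀ᵐ x ∂m, f.1 x = 0 → b.op (u n) x = 0 := fun n => by
    filter_upwards [b.leibniz (u n) (χ n)] with x hx h0
    rw [← huχ, hu0 n x (by rw [h0, abs_zero]; exact (hεpos n).le), hχx, h0] at hx
    simpa using hx
  have hlip : ∀ n, LipB.lipNorm (u n) ≤ L + ‖f.1‖ + 1 := fun n => by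
    refine (LipB.lipNorm_le (norm_nonneg f.1) (ExtDist.IsLip.sup ?_ (ExtDist.IsLip.inf ?_
      (ExtDist.IsLip.const d L 0))) (hule n)).trans (by linarith)
    · exact (ExtDist.IsLip.add_const hL (-ε n) :)
    · exact (ExtDist.IsLip.add_const hL (ε n) :)
  have hlipf : LipB.lipNorm f ≤ L + ‖f.1‖ + 1 :=
    (LipB.lipNorm_le (norm_nonneg f.1) hL f.1.norm_coe_le_norm).trans (by linarith)
  have hlim : ∀ x, Tendsto (fun n => (u n).1 x) atTop (𝓝 (f.1 x)) := fun x => by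
    rw [tendsto_iff_dist_tendsto_zero]
    exact squeeze_zero (fun _ => dist_nonneg) (fun n => huclose n x)
      tendsto_one_div_add_atTop_nhds_zero_nat
  have hZ : MeasurableSet {x | f.1 x = 0} :=
    f.1.continuous.measurable (measurableSet_singleton 0)
  set Z := {x | f.1 x = 0}
  -- the limit is tested against the restriction of `b f` itself to the zero set
  have hbi : Integrable (b.op f) m := (Lp.mem_Lp_iff_memLp.1 (hb.1 f)).integrable le_top
  have ht := WeaverDer.tendsto hb (by positivity) hlip hlipf hlim (hbi.indicator hZ)
  have hzero : ∀ n, ∫ x, Z.indicator (b.op f) x * b.op (u n) x ∂m = 0 := fun n => by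
    refine integral_eq_zero_of_ae ?_
    filter_upwards [hbu n] with x hx
    by_cases hxZ : x ∈ Z
    · simp [hx hxZ]
    · simp [hxZ]
  simp only [hzero] at ht
  have hsq := tendsto_nhds_unique ht tendsto_const_nhds
  obtain ⟨C, hC, hbC⟩ := exists_ae_abs_le (hb.1 f)
  have hnn : 0 ≤ fun x => Z.indicator (b.op f) x * b.op f x := fun x => by
    by_cases hxZ : x ∈ Z
    · simpa [hxZ] using mul_self_nonneg _
    · simp [hxZ]
  rw [integral_eq_zero_iff_of_nonneg hnn
    ((hbi.indicator hZ).mul_bdd (b.op f).aestronglyMeasurable hbC)] at hsq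
  filter_upwards [hsq] with x hx h0
  have hxZ : x ∈ Z := h0
  simpa [hxZ] using hx

/-- Locality: a Weaver derivation takes equal values, almost everywhere, where two functions differ
by a constant. -/
lemma WeaverDer.ae_eq_of_eq_add_const [BorelSpace X] {b : LipDer d m} (hb : b ∈ WeaverDer d m)
    (f g : LipB d) (c : ℝ) : ∀ᵐ x ∂m, f.1 x = g.1 x + c → b.op f x = b.op g x := by
  filter_upwards [WeaverDer.ae_eq_zero_of_eq_zero hb (f - g - c • 1), b.op_sub_ae (f - g) (c • 1),
    b.op_sub_ae f g, b.op_smul_ae c 1, b.op_one_ae] with x h1 h2 h3 h4 h5 h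
  have h0 : (f - g - c • (1 : LipB d)).1 x = 0 := by
    change f.1 x - g.1 x - c * 1 = 0
    rw [h]
    ring
  have := h1 h0
  rw [h2, h3, h4, h5] at this
  linarith

/-! ### Pointwise bounds for Weaver derivations -/

/-- The supremum norm is removed from `|b f| ≤ g ‖f‖` by cutting `f` into slices of height `ε`: on
`{k ε ≤ f ≤ (k + 1) ε}`, the function `f` agrees up to a constant with a truncation of norm at most
`L + ε`. -/
lemma WeaverDer.ae_abs_le_mul_lip [BorelSpace X] {b : LipDer d m} (hb : b ∈ WeaverDer d m)
    {g : X →ₘ[m] ℝ} (hg : g ∈ b.normBounds) {f : LipB d} {L : ℝ≥0} (hL : d.IsLip L f.1) :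
    ∀ᵐ x ∂m, |b.op f x| ≤ g x * L := by
  have hg0 : ∀ᵐ x ∂m, 0 ≤ g x := by
    filter_upwards [AEEqFun.coeFn_le.2 hg.2.1, AEEqFun.coeFn_zero (α := X) (β := ℝ) (μ := m)]
      with x h1 h2
    rw [h2] at h1
    exact h1
  have step : ∀ ε : ℝ, 0 < ε → ∀ᵐ x ∂m, |b.op f x| ≤ g x * (L + ε) := by
    intro ε hε
    set c : ℝ → X →ᵇ ℝ := BoundedContinuousFunction.const X with hc
    have hcm : ∀ r, c r ∈ LipB d := LipB.const_mem
    set t : ℤ → LipB d := fun k => ⟨c 0 ⊔ ((f.1 + c (-(k * ε))) ⊓ c ε),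
      LipB.sup_mem (hcm _) (LipB.inf_mem (add_mem f.2 (hcm _)) (hcm _))⟩ with ht
    have htx : ∀ k x, (t k).1 x = 0 ⊔ ((f.1 x + -(k * ε)) ⊓ ε) := fun k x => rfl
    have htn : ∀ k, LipB.lipNorm (t k) ≤ L + ε := fun k => by
      refine LipB.lipNorm_le hε.le (ExtDist.IsLip.sup (ExtDist.IsLip.const d L 0)
        (ExtDist.IsLip.inf (ExtDist.IsLip.add_const hL _) (ExtDist.IsLip.const d L ε)))
        fun x => ?_
      rw [htx, abs_of_nonneg le_sup_left]
      exact sup_le hε.le inf_le_right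
    filter_upwards [hg0, ae_all_iff.2 fun k : ℤ => hg.2.2 (t k),
      ae_all_iff.2 fun k : ℤ => WeaverDer.ae_eq_of_eq_add_const hb f (t k) (k * ε)]
      with x h1 h2 h3
    set k : ℤ := ⌊f.1 x / ε⌋ with hk
    have hk1 : k * ε ≤ f.1 x := (le_div_iff₀ hε).1 (Int.floor_le _)
    have hk2 : f.1 x < (k + 1) * ε := (div_lt_iff₀ hε).1 (Int.lt_floor_add_one _)
    have e : f.1 x = (t k).1 x + k * ε := by
      rw [htx, inf_eq_left.2 (by linarith), sup_eq_right.2 (by linarith)]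
      ring
    rw [h3 k e]
    exact (h2 k).trans (mul_le_mul_of_nonneg_left (htn k) h1)
  filter_upwards [ae_all_iff.2 fun n : ℕ => step (1 / ((n : ℝ) + 1)) (by positivity)] with x hx
  have hlim : Tendsto (fun n : ℕ => g x * ((L : ℝ) + 1 / ((n : ℝ) + 1))) atTop
      (𝓝 (g x * (L + 0))) :=
    (tendsto_const_nhds.add tendsto_one_div_add_atTop_nhds_zero_nat).const_mul _
  rw [add_zero] at hlim
  exact ge_of_tendsto' hlim hx

/-- The bound localises: on a compact set on which `f` is `L`-Lipschitz, `f` agrees with a function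
that is `L'`-Lipschitz on the whole space, and `b` is local. -/
lemma WeaverDer.ae_abs_le_on_compact (hX : IsEMTMSpace d m) {b : LipDer d m}
    (hb : b ∈ WeaverDer d m) {g : X →ₘ[m] ℝ} (hg : g ∈ b.normBounds) {f : LipB d} {K : Set X}
    (hK : IsCompact K) {L L' : ℝ≥0} (hLL' : L < L')
    (hfL : ∀ x ∈ K, ∀ y ∈ K, edist (f.1 x) (f.1 y) ≤ L * d.dist x y) :
    ∀ᵐ x ∂m, x ∈ K → |b.op f x| ≤ g x * L' := by
  have := hX.borel
  obtain ⟨F, hF, hFK⟩ :=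
    LipB.exists_extension hX.recovery hK f.1.continuous.continuousOn hLL' hfL
  filter_upwards [WeaverDer.ae_abs_le_mul_lip hb hg hF, WeaverDer.ae_eq_of_eq_add_const hb f F 0]
    with x h1 h2 hxK
  rwa [h2 (by rw [hFK x hxK, add_zero])]

/-- A property that holds almost everywhere on each compact subset of a measurable set holds almost
everywhere on that set. -/
lemma ae_imp_of_forall_compact [T2Space X] [BorelSpace X] [m.InnerRegular] {A : Set X}
    (hA : MeasurableSet A) {p : X → Prop}
    (h : ∀ K ⊆ A, IsCompact K → ∀ᵐ x ∂m, x ∈ K → p x) : ∀ᵐ x ∂m, x ∈ A → p x := by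
  choose! K hKA hK hmK using fun n : ℕ =>
    hA.exists_isCompact_sdiff_lt (measure_ne_top m A) (ε := ((n : ℝ≥0∞) + 1)⁻¹) (by simp)
  have hnull : m (A \ ⋃ n, K n) = 0 := by
    refine le_antisymm (le_of_tendsto_of_tendsto' tendsto_const_nhds
      ENNReal.tendsto_inv_nat_nhds_zero fun n => ?_) zero_le
    refine (measure_mono (Set.sdiff_subset_sdiff_right (Set.subset_iUnion K n))).trans
      ((hmK n).le.trans ?_)
    exact ENNReal.inv_le_inv.2 le_self_add
  filter_upwards [ae_all_iff.2 fun n => h (K n) (hKA n) (hK n),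
    measure_eq_zero_iff_ae_notMem.1 hnull] with x h1 h2 hxA
  by_contra hp
  exact h2 ⟨hxA, fun hx => by
    obtain ⟨n, hn⟩ := Set.mem_iUnion.1 hx
    exact hp (h1 n hn)⟩

/-- For a Weaver derivation, `|b f| ≤ g ‖f‖` for all `f` improves to `|b f| ≤ g lip_d(f)`. The set
`{lip_d(f) < q}` is a union of open sets on which `f` is `q`-Lipschitz; by inner regularity the
bound on compact subsets of these suffices. -/
lemma WeaverDer.mem_slopeBounds (hX : IsEMTMSpace d m) {b : LipDer d m} (hb : b ∈ WeaverDer d m)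
    {g : X →ₘ[m] ℝ} (hg : g ∈ b.normBounds) : g ∈ b.slopeBounds := by
  have := hX.hausdorff
  have := hX.borel
  have := hX.radon
  refine ⟨hg.2.1, fun f => ?_⟩
  -- rational bounds `q < r` of the slope
  have key : ∀ q r : ℚ, 0 < q → q < r → ∀ᵐ x ∂m, LipB.slope f x < q → |b.op f x| ≤ g x * r := by
    intro q r hq hqr
    set L : ℝ≥0 := Real.toNNReal q with hLdef
    set L' : ℝ≥0 := Real.toNNReal r with hL'def
    have hr : (L' : ℝ) = r := Real.coe_toNNReal _ (by exact_mod_cast (hq.trans hqr).le)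
    have hL : 0 < L := Real.toNNReal_pos.2 (by exact_mod_cast hq)
    have hLL' : L < L' :=
      (Real.toNNReal_lt_toNNReal_iff (by exact_mod_cast hq.trans hqr)).2 (by exact_mod_cast hqr)
    set O : Set (Set X) := {U | IsOpen U ∧ LipB.lipOn f U ≤ L} with hO
    have hOo : IsOpen (⋃₀ O) := isOpen_sUnion fun U hU => hU.1
    have hon : ∀ U ∈ O, ∀ᵐ x ∂m, x ∈ U → |b.op f x| ≤ g x * r := fun U hU =>
      ae_imp_of_forall_compact hU.1.measurableSet fun K hKU hK => by
        rw [← hr]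
        exact WeaverDer.ae_abs_le_on_compact hX hb hg hK hLL' fun x hx y hy =>
          LipB.edist_le_of_lipOn_le hL hU.2 (hKU hx) (hKU hy)
    have hall : ∀ᵐ x ∂m, x ∈ ⋃₀ O → |b.op f x| ≤ g x * r := by
      refine ae_imp_of_forall_compact hOo.measurableSet fun K hKO hK => ?_
      refine hK.induction_on (p := fun s => ∀ᵐ x ∂m, x ∈ s → |b.op f x| ≤ g x * r) (by simp)
        (fun s t hst h => h.mono fun x hx hxs => hx (hst hxs)) (fun s t hs ht => ?_) fun x hx => ?_
      · filter_upwards [hs, ht] with x h1 h2 h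
        exact h.elim h1 h2
      · obtain ⟨U, hU, hxU⟩ := hKO hx
        exact ⟨U, mem_nhdsWithin_of_mem_nhds (hU.1.mem_nhds hxU), hon U hU⟩
    filter_upwards [hall] with x hx hsl
    obtain ⟨U, hU, hxU, hUL⟩ := LipB.exists_isOpen_lipOn_le_of_slope_lt hsl
    exact hx ⟨U, ⟨hU, hUL⟩, hxU⟩
  have hall : ∀ᵐ x ∂m, ∀ q r : ℚ, 0 < q → q < r → LipB.slope f x < q → |b.op f x| ≤ g x * r := by
    simp only [ae_all_iff]
    exact key
  filter_upwards [hall, AEEqFun.coeFn_le.2 hg.2.1, AEEqFun.coeFn_zero (α := X) (β := ℝ) (μ := m)]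
    with x h1 h2 h3
  rw [h3] at h2
  have h2 : 0 ≤ g x := h2
  have hs := LipB.slope_nonneg f x
  have hr : ∀ r : ℝ, LipB.slope f x < r → |b.op f x| ≤ g x * r := fun r hr => by
    obtain ⟨r', hr1, hr2⟩ := exists_rat_btwn hr
    obtain ⟨q, hq1, hq2⟩ := exists_rat_btwn hr1
    refine (h1 q r' (by exact_mod_cast hs.trans_lt hq1) (by exact_mod_cast hq2) hq1).trans ?_
    exact mul_le_mul_of_nonneg_left hr2.le h2
  have hlim : Tendsto (fun n : ℕ => g x * (LipB.slope f x + 1 / ((n : ℝ) + 1))) atTop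
      (𝓝 (g x * (LipB.slope f x + 0))) :=
    (tendsto_const_nhds.add tendsto_one_div_add_atTop_nhds_zero_nat).const_mul _
  rw [add_zero] at hlim
  exact ge_of_tendsto' hlim fun n => hr _ (lt_add_of_pos_right _ (by positivity))

end Weaver

theorem theorem4p14 {X : Type*} [TopologicalSpace X] [MeasurableSpace X]
    (d : ExtDist X) (m : Measure X) (hX : IsEMTMSpace d m) (hsep : MeasureTheory.IsSeparable m) :
    (DerQR d m ∞ 1 ⊆ WeaverDer d m ∧
      ∀ b ∈ DerQR d m ∞ 1,
        IsGLB b.normBounds b.absW ∧ IsGLB b.slopeBounds b.absDM ∧ b.absW ≤ b.absDM) ∧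
    ((∀ K : Set X, IsCompact K → TopologicalSpace.MetrizableSpace K) →
      WeaverDer d m ⊆ DerQ d m ∞ ∧
      ∀ b ∈ WeaverDer d m,
        IsGLB b.normBounds b.absW ∧ IsGLB b.slopeBounds b.absDM ∧ b.absW = b.absDM) := by
  have := hX.finite
  refine ⟨⟨derQR_top_one_subset_weaverDer hX, fun b hb => ?_⟩,
    fun _ => ⟨fun b hb => ?_, fun b hb => ?_⟩⟩
  · have hDM := LipDer.absDM_mem_normBounds hb.1
    have hW := LipDer.isLeast_absW ⟨_, hDM⟩
    exact ⟨hW.isGLB, (LipDer.isLeast_absDM hb.1).isGLB, hW.2 hDM⟩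
  · obtain ⟨g, hg⟩ := WeaverDer.normBounds_nonempty hb
    exact ⟨g, WeaverDer.mem_slopeBounds hX hb hg, hg.1⟩
  · have hW := LipDer.isLeast_absW (WeaverDer.normBounds_nonempty hb)
    have hWs := WeaverDer.mem_slopeBounds hX hb hW.1
    have hQ : b ∈ DerQ d m ∞ := ⟨_, hWs, hW.1.1⟩
    have hDM := LipDer.isLeast_absDM hQ
    exact ⟨hW.isGLB, hDM.isGLB,
      le_antisymm (hW.2 (LipDer.absDM_mem_normBounds hQ)) (hDM.2 hWs)⟩
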